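/- For an index $k=(k_1,\dots,k_d)$ of positive integers with $d=0$ or $k_d\ge2$ let $$\zeta(k_1,\dots,k_d)=\sum_{0<m_1<\cdots<m_d}\frac1{m_1^{k_1}\cdots m_d^{k_d}},\qquad \zeta(\varnothing)=1 .$$ Let $\zeta^*$ be the stuffle regularized multiple zeta values: the unique real-valued function on all indices of positive integers that extends $\zeta$, satisfies $\zeta^*(1)=0$, and is multiplicative for the stuffle (harmonic) product, i.e. $\zeta^*(u)\zeta^*(v)=\zeta^*(u*v)$ where $\zeta^*$ is extended linearly to formal sums of indices and $*$ is the bilinear product with $\varnothing*u=u*\varnothing=u$ and $(a,u)*(b,v)=(a,u*(b,v))+(b,(a,u)*v)+(a+b,u*v)$. Let $$\zeta^{\star,*}(k_1,\dots,k_d)=\sum_{\square_1,\dots,\square_{d-1}\in\{\,\text{``,''},\,\text{``+''}\,\}}\zeta^*(k_1\,\square_1\cdots\square_{d-1}\,k_d),\qquad \zeta^{\star,*}(\varnothing)=1,$$ and for an integer $a\ge0$ let $$\zeta_a^*(k_1,\dots,k_d)=(-1)^a\sum_{\substack{a_1+\cdots+a_d=a\\ a_1,\dots,a_d\ge0}}\zeta^*(k_1+a_1,\dots,k_d+a_d)\prod_{j=1}^d\binom{k_j-1+a_j}{a_j}$$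 (so $\zeta_0^*(\varnothing)=1$ and $\zeta_a^*(\varnothing)=0$ for $a>0$). Let $\delta^{k_1,\dots,k_d}=\frac{(-1)^n\pi^{2n}}{(2n)!}$ if $(k_1,\dots,k_d)=(1,\dots,1)$ with $d=2n$ for some $n\ge0$, and $\delta^{k_1,\dots,k_d}=0$ otherwise. Let $B_{2m}$ denote the Bernoulli numbers. Then, for all positive integers $k_1,\dots,k_d$, $$\begin{aligned} &(-1)^d\zeta^{\star,*}(k_1,\dots,k_d)-(-1)^{k_1+\cdots+k_d}\zeta^*(k_1,\dots,k_d)\\ &=-\sum_{i=0}^{d-1}(-1)^i\zeta^{\star,*}(k_1,\dots,k_i)\,\delta^{k_{i+1},\dots,k_d}\\ &\quad+\sum_{0\le i<j\le d}\ \sum_{\substack{a+2m+b=k_j\\ a,b,m\ge0}}(-1)^{i+b+k_{j+1}+\cdots+k_d+m}\frac{(2\pi)^{2m}}{(2m)!}B_{2m}\\ &\qquad\qquad\times\zeta^{\star,*}(k_1,\dots,k_i)\,\zeta_a^*(k_{j-1},\dots,k_{i+1})\,\zeta_b^*(k_{j+1},\dots,k_d). \end{aligned}$$ -/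

import Mathlib

namespace MZV

/-- The index `(k_1, …, k_d)` is admissible: it is empty or `k_d ≥ 2`. -/
def Admissible (k : List ℕ+) : Prop := ∀ x ∈ k.getLast?, x ≠ 1

/-- The multiple zeta value
`ζ(k_1, …, k_d) = ∑_{0 < m_1 < ⋯ < m_d} 1 / (m_1 ^ k_1 ⋯ m_d ^ k_d)`
of an admissible index (with `ζ(∅) = 1`). -/
noncomputable def mzv (k : List ℕ+) : ℝ :=
  ∑' m : {m : Fin k.length → ℕ // StrictMono m ∧ ∀ i, 0 < m i},
    ∏ i, (1 : ℝ) / (m.1 i : ℝ) ^ (k.get i : ℕ)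

/-- The stuffle (harmonic) product of two indices, as a formal sum of indices, i.e. the multiset
of the indices that occur in it. -/
def stuffle : List ℕ+ → List ℕ+ → Multiset (List ℕ+)
  | [], v => {v}
  | a :: u, [] => {a :: u}
  | a :: u, b :: v =>
      (stuffle u (b :: v)).map (a :: ·) + (stuffle (a :: u) v).map (b :: ·)
        + (stuffle u v).map ((a + b) :: ·)
termination_by u v => u.length + v.length

/-- `Z` is the stuffle regularization (with `T = 0`): it extends the multiple zeta values,
is multiplicative for the stuffle product, and sends the index `(1)` to `0`. -/
structure IsStuffleRegularization (Z : List ℕ+ → ℝ) : Prop where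
  eq_mzv : ∀ k, Admissible k → Z k = mzv k
  one : Z [1] = 0
  mul : ∀ u v, Z u * Z v = ((stuffle u v).map Z).sum



theorem stuffle_nil_right (u : List ℕ+) : stuffle u [] = {u} := by
  cases u <;> simp [stuffle]

theorem stuffle_cons_cons (a b : ℕ+) (u v : List ℕ+) :
    stuffle (a :: u) (b :: v) = (stuffle u (b :: v)).map (a :: ·)
      + (stuffle (a :: u) v).map (b :: ·) + (stuffle u v).map ((a + b) :: ·) := by
  rw [stuffle]

/-- The words with a letter `≠ 1` and at most `n` letters `1` after the last such letter. -/
def TailOnes (n : ℕ) (w : List ℕ+) : Prop :=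
  ∃ (v : List ℕ+) (x : ℕ+) (j : ℕ), x ≠ 1 ∧ j ≤ n ∧ w = v ++ x :: List.replicate j 1

theorem TailOnes.cons {n : ℕ} {w : List ℕ+} (a : ℕ+) (h : TailOnes n w) : TailOnes n (a :: w) := by
  obtain ⟨v, x, j, hx, hj, rfl⟩ := h
  exact ⟨a :: v, x, j, hx, hj, rfl⟩

theorem pnat_add_ne_one (a b : ℕ+) : a + b ≠ 1 := by
  intro h
  have := congrArg PNat.val h
  have ha := a.pos
  have hb := b.pos
  simp at this
  omega

theorem stuffle_replicate_one (n : ℕ) : ∃ M : Multiset (List ℕ+),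
    stuffle (List.replicate n 1) [1] = (n + 1) • {List.replicate (n + 1) 1} + M ∧
      ∀ w ∈ M, TailOnes n w := by
  induction n with
  | zero => exact ⟨0, by simp [stuffle], by simp⟩
  | succ n ih =>
    obtain ⟨M, hM, hT⟩ := ih
    refine ⟨M.map (1 :: ·) + {(1 + 1) :: List.replicate n 1}, ?_, ?_⟩
    · rw [List.replicate_succ, stuffle_cons_cons, hM, stuffle_nil_right, stuffle_nil_right,
        Multiset.map_add, Multiset.map_nsmul, succ_nsmul _ (n + 1)]
      simp only [Multiset.map_singleton, List.replicate_succ]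
      abel
    · intro w hw
      rcases Multiset.mem_add.1 hw with hw | hw
      · obtain ⟨w', hw', rfl⟩ := Multiset.mem_map.1 hw
        obtain ⟨v, x, j, hx, hj, rfl⟩ := hT w' hw'
        exact ⟨1 :: v, x, j, hx, by omega, rfl⟩
      · rw [Multiset.mem_singleton.1 hw]
        exact ⟨[], 1 + 1, n, pnat_add_ne_one 1 1, by omega, rfl⟩

/-- Multiplying a word with `n` final letters `1` by the word `1`. -/
theorem stuffle_one (v : List ℕ+) (x : ℕ+) (hx : x ≠ 1) (n : ℕ) : ∃ M : Multiset (List ℕ+),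
    stuffle (v ++ x :: List.replicate n 1) [1]
      = (n + 1) • {v ++ x :: List.replicate (n + 1) 1} + M ∧ ∀ w ∈ M, TailOnes n w := by
  induction v with
  | nil =>
    obtain ⟨M, hM, hT⟩ := stuffle_replicate_one n
    refine ⟨M.map (x :: ·) + {1 :: x :: List.replicate n 1} +
      {(x + 1) :: List.replicate n 1}, ?_, ?_⟩
    · rw [List.nil_append, stuffle_cons_cons, hM, stuffle_nil_right, stuffle_nil_right,
        Multiset.map_add, Multiset.map_nsmul]
      simp only [Multiset.map_singleton, List.nil_append]
      abel
    · intro w hw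
      rcases Multiset.mem_add.1 hw with hw | hw
      · rcases Multiset.mem_add.1 hw with hw | hw
        · obtain ⟨w', hw', rfl⟩ := Multiset.mem_map.1 hw
          exact (hT w' hw').cons x
        · rw [Multiset.mem_singleton.1 hw]
          exact ⟨[1], x, n, hx, le_rfl, rfl⟩
      · rw [Multiset.mem_singleton.1 hw]
        exact ⟨[], x + 1, n, pnat_add_ne_one x 1, le_rfl, rfl⟩
  | cons a v ih =>
    obtain ⟨M, hM, hT⟩ := ih
    refine ⟨M.map (a :: ·) + {1 :: a :: (v ++ x :: List.replicate n 1)} +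
      {(a + 1) :: (v ++ x :: List.replicate n 1)}, ?_, ?_⟩
    · rw [List.cons_append, stuffle_cons_cons, hM, stuffle_nil_right, stuffle_nil_right,
        Multiset.map_add, Multiset.map_nsmul]
      simp only [Multiset.map_singleton, List.cons_append]
      abel
    · have hb : TailOnes n (v ++ x :: List.replicate n 1) := ⟨v, x, n, hx, le_rfl, rfl⟩
      intro w hw
      rcases Multiset.mem_add.1 hw with hw | hw
      · rcases Multiset.mem_add.1 hw with hw | hw
        · obtain ⟨w', hw', rfl⟩ := Multiset.mem_map.1 hw
          exact (hT w' hw').cons a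
        · rw [Multiset.mem_singleton.1 hw]
          exact (hb.cons a).cons 1
      · rw [Multiset.mem_singleton.1 hw]
        exact hb.cons (a + 1)

theorem tailOnes_or (w : List ℕ+) : (∃ n, w = List.replicate n 1) ∨ ∃ n, TailOnes n w := by
  induction w with
  | nil => exact Or.inl ⟨0, rfl⟩
  | cons a w ih =>
    rcases ih with ⟨n, rfl⟩ | ⟨n, h⟩
    · by_cases ha : a = 1
      · exact Or.inl ⟨n + 1, by rw [ha, List.replicate_succ]⟩
      · exact Or.inr ⟨n, [], a, n, ha, le_rfl, rfl⟩
    · exact Or.inr ⟨n, h.cons a⟩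

/-- Induction along the final letters `1` of a word, by means of products with the word `1`. -/
theorem stuffle_induction {C : List ℕ+ → Prop} (hadm : ∀ k, Admissible k → C k)
    (hstep : ∀ (n : ℕ) (u w : List ℕ+) (M : Multiset (List ℕ+)), C u →
      stuffle u [1] = (n + 1) • {w} + M → (∀ w' ∈ M, C w') → C w) (w : List ℕ+) : C w := by
  have hT : ∀ n w, TailOnes n w → C w := by
    intro n
    induction n with
    | zero =>
      rintro w ⟨v, x, j, hx, hj, rfl⟩
      apply hadm
      obtain rfl : j = 0 := by omega
      simpa [Admissible] using hx
    | succ n ih =>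
      rintro w ⟨v, x, j, hx, hj, rfl⟩
      rcases Nat.lt_or_ge j (n + 1) with hj' | hj'
      · exact ih _ ⟨v, x, j, hx, by omega, rfl⟩
      · obtain rfl : j = n + 1 := by omega
        obtain ⟨M, hM, hMT⟩ := stuffle_one v x hx n
        exact hstep n _ _ M (ih _ ⟨v, x, n, hx, le_rfl, rfl⟩) hM fun w' hw' => ih _ (hMT w' hw')
  have h1 : ∀ n, C (List.replicate n 1) := by
    intro n
    induction n with
    | zero => exact hadm _ (by simp [Admissible])
    | succ n ih =>
      obtain ⟨M, hM, hMT⟩ := stuffle_replicate_one n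
      exact hstep n _ _ M ih hM fun w' hw' => hT n _ (hMT w' hw')
  rcases tailOnes_or w with ⟨n, rfl⟩ | ⟨n, h⟩
  · exact h1 n
  · exact hT n w h

theorem IsStuffleRegularization.unique {Z Z' : List ℕ+ → ℝ} (h : IsStuffleRegularization Z)
    (h' : IsStuffleRegularization Z') : Z = Z' := by
  funext w
  induction w using stuffle_induction with
  | hadm k hk => rw [h.eq_mzv k hk, h'.eq_mzv k hk]
  | hstep n u w M hu hM ih =>
    have e := h.mul u [1]
    have e' := h'.mul u [1]
    rw [h.one, hM, mul_zero, Multiset.map_add, Multiset.sum_add, Multiset.map_nsmul,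
      Multiset.sum_nsmul, Multiset.map_singleton, Multiset.sum_singleton, nsmul_eq_mul] at e
    rw [h'.one, hM, mul_zero, Multiset.map_add, Multiset.sum_add, Multiset.map_nsmul,
      Multiset.sum_nsmul, Multiset.map_singleton, Multiset.sum_singleton, nsmul_eq_mul,
      ← Multiset.map_congr rfl ih] at e'
    have hn : ((n + 1 : ℕ) : ℝ) ≠ 0 := by positivity
    apply mul_left_cancel₀ hn
    linarith

/-- The truncated sum over `m < m_1 < ⋯ ≤ N` (with `r = N - m`), the words left over
at the end being weighted by `f`. -/
noncomputable def trunc (f : List ℕ+ → ℝ) (N : ℕ) : ℕ → List ℕ+ → ℝ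
  | 0, w => f w
  | r + 1, [] => trunc f N r []
  | r + 1, a :: u => trunc f N r (a :: u) + (1 / ((N - r : ℕ) : ℝ) ^ (a : ℕ)) * trunc f N r u

theorem trunc_mul {f : List ℕ+ → ℝ} (h0 : f [] = 1)
    (hf : ∀ u v, f u * f v = ((stuffle u v).map f).sum) (N r : ℕ) :
    trunc f N r [] = 1 ∧
    ∀ u v, trunc f N r u * trunc f N r v = ((stuffle u v).map (trunc f N r)).sum := by
  induction r with
  | zero => exact ⟨h0, hf⟩
  | succ r ih =>
    obtain ⟨ih0, ih⟩ := ih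
    have e0 : trunc f N (r + 1) [] = 1 := ih0
    refine ⟨e0, ?_⟩
    rintro (_ | ⟨a, u⟩) v
    · simp [stuffle, e0]
    rcases v with _ | ⟨b, v⟩
    · simp [stuffle, e0]
    have h1 := ih (a :: u) (b :: v)
    have h2 := ih u (b :: v)
    have h3 := ih (a :: u) v
    have h4 := ih u v
    simp only [stuffle_cons_cons, Multiset.map_add, Multiset.sum_add, Multiset.map_map,
      Function.comp_def, trunc, Multiset.sum_map_add, Multiset.sum_map_mul_left] at h1 ⊢
    rw [← h2, ← h3, ← h4]
    have hp : (1 / ((N - r : ℕ) : ℝ) ^ ((a + b : ℕ+) : ℕ)) =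
        (1 / ((N - r : ℕ) : ℝ) ^ (a : ℕ)) * (1 / ((N - r : ℕ) : ℝ) ^ (b : ℕ)) := by
      rw [PNat.add_coe, pow_add]; ring
    rw [hp]
    linear_combination h1

/-- The weight `c ^ n / n !` of the word `1 ⋯ 1` with `n` letters, and `0` of other words. -/
noncomputable def oneExp (c : ℝ) (w : List ℕ+) : ℝ :=
  if ∀ x ∈ w, x = 1 then c ^ w.length / (w.length.factorial : ℝ) else 0

theorem oneExp_of_mem {c : ℝ} {w : List ℕ+} {x : ℕ+} (h : x ∈ w) (hx : x ≠ 1) :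
    oneExp c w = 0 := if_neg fun h' => hx (h' x h)

theorem stuffle_ne_one (u v : List ℕ+) (h : (∃ x ∈ u, x ≠ 1) ∨ ∃ x ∈ v, x ≠ 1) :
    ∀ w ∈ stuffle u v, ∃ x ∈ w, x ≠ 1 := by
  induction u, v using stuffle.induct with
  | case1 v => simpa [stuffle] using h
  | case2 a u => simpa [stuffle] using h
  | case3 a u b v ih1 ih2 ih3 =>
    intro w hw
    rw [stuffle_cons_cons, Multiset.mem_add, Multiset.mem_add] at hw
    rcases hw with (hw | hw) | hw
    · obtain ⟨w', hw', rfl⟩ := Multiset.mem_map.1 hw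
      by_cases ha : a = 1
      · obtain ⟨x, hx, hx1⟩ := ih1 (by simpa [ha] using h) w' hw'
        exact ⟨x, List.mem_cons_of_mem _ hx, hx1⟩
      · exact ⟨a, List.mem_cons_self, ha⟩
    · obtain ⟨w', hw', rfl⟩ := Multiset.mem_map.1 hw
      by_cases hb : b = 1
      · obtain ⟨x, hx, hx1⟩ := ih2 (by simpa [hb] using h) w' hw'
        exact ⟨x, List.mem_cons_of_mem _ hx, hx1⟩
      · exact ⟨b, List.mem_cons_self, hb⟩
    · obtain ⟨w, hw, rfl⟩ := Multiset.mem_map.1 hw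
      exact ⟨a + b, List.mem_cons_self, pnat_add_ne_one a b⟩

theorem sum_map_zero {s : Multiset (List ℕ+)} {g : List ℕ+ → ℝ} (h : ∀ w ∈ s, g w = 0) :
    (s.map g).sum = 0 := by
  rw [Multiset.map_congr rfl h]; simp

theorem oneExp_replicate (c : ℝ) (n : ℕ) :
    oneExp c (List.replicate n 1) = c ^ n / (n.factorial : ℝ) := by
  rw [oneExp, if_pos fun x hx => List.eq_of_mem_replicate hx, List.length_replicate]

theorem sum_oneExp_replicate (c : ℝ) (s p q r : ℕ) (hs : p + q = s) :
    ((stuffle (List.replicate p 1) (List.replicate q 1)).map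
      fun w => oneExp c (List.replicate r 1 ++ w)).sum
      = ((p + q).choose p : ℝ) * (c ^ (p + q + r) / ((p + q + r).factorial : ℝ)) := by
  induction s generalizing p q r with
  | zero =>
    obtain ⟨rfl, rfl⟩ : p = 0 ∧ q = 0 := by omega
    simp [stuffle, oneExp_replicate]
  | succ s ih =>
    rcases p with _ | p
    · simp [stuffle, oneExp_replicate, List.replicate_append_replicate, add_comm]
    rcases q with _ | q
    · simp [stuffle_nil_right, oneExp_replicate, List.replicate_append_replicate, add_comm]
    have hc : ∀ w : List ℕ+, List.replicate r (1 : ℕ+) ++ 1 :: w = List.replicate (r + 1) 1 ++ w := by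
      intro w
      rw [List.replicate_succ', List.append_assoc]; rfl
    have h1 := ih p (q + 1) (r + 1) (by omega)
    have h2 := ih (p + 1) q (r + 1) (by omega)
    simp only [List.replicate_succ (n := p), List.replicate_succ (n := q)] at h1 h2 ⊢
    rw [stuffle_cons_cons]
    simp only [Multiset.map_add, Multiset.sum_add, Multiset.map_map, Function.comp_def, hc]
    rw [h1, h2, sum_map_zero (fun w _ => oneExp_of_mem (x := 1 + 1) (by simp)
      (pnat_add_ne_one 1 1))]
    have e : p + 1 + (q + 1) + r = p + q + r + 2 := by ring
    have e1 : p + (q + 1) + (r + 1) = p + q + r + 2 := by ring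
    have e2 : p + 1 + q + (r + 1) = p + q + r + 2 := by ring
    have e3 : (p + 1 + (q + 1)).choose (p + 1)
        = (p + (q + 1)).choose p + (p + 1 + q).choose (p + 1) := by
      rw [show p + 1 + (q + 1) = (p + q + 1) + 1 by ring, Nat.choose_succ_succ,
        show p + (q + 1) = p + q + 1 by ring, show p + 1 + q = p + q + 1 by ring]
    rw [e, e1, e2, e3]
    push_cast
    ring

theorem oneExp_mul (c : ℝ) (u v : List ℕ+) :
    oneExp c u * oneExp c v = ((stuffle u v).map (oneExp c)).sum := by
  by_cases hu : ∀ x ∈ u, x = 1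
  · by_cases hv : ∀ x ∈ v, x = 1
    · have e := sum_oneExp_replicate c _ u.length v.length 0 rfl
      rw [← List.eq_replicate_of_mem hu, ← List.eq_replicate_of_mem hv] at e
      simp only [List.replicate_zero, List.nil_append, add_zero] at e
      rw [show (fun w => oneExp c w) = oneExp c from rfl] at e
      rw [e, oneExp, oneExp, if_pos hu, if_pos hv, Nat.cast_add_choose]
      have := Nat.factorial_ne_zero (u.length + v.length)
      field_simp
      rw [pow_add]
    · push Not at hv
      rw [sum_map_zero fun w hw => ?_]
      · obtain ⟨x, hx, hx1⟩ := hv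
        rw [oneExp_of_mem hx hx1, mul_zero]
      · obtain ⟨x, hx, hx1⟩ := stuffle_ne_one u v (Or.inr hv) w hw
        exact oneExp_of_mem hx hx1
  · push Not at hu
    rw [sum_map_zero fun w hw => ?_]
    · obtain ⟨x, hx, hx1⟩ := hu
      rw [oneExp_of_mem hx hx1, zero_mul]
    · obtain ⟨x, hx, hx1⟩ := stuffle_ne_one u v (Or.inl hu) w hw
      exact oneExp_of_mem hx hx1

/-- The strictly increasing tuples with entries `> lo` and `≤ N`. -/
noncomputable def tuples (N lo d : ℕ) : Finset (Fin d → ℕ) :=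
  open Classical in
  (Fintype.piFinset fun _ => Finset.range (N + 1)).filter
    fun m => StrictMono m ∧ ∀ i, lo < m i

theorem mem_tuples {N lo d : ℕ} {m : Fin d → ℕ} :
    m ∈ tuples N lo d ↔ (∀ i, m i ≤ N) ∧ StrictMono m ∧ ∀ i, lo < m i := by
  simp [tuples]

/-- The summand of the multiple zeta value. -/
noncomputable def term (k : List ℕ+) (m : Fin k.length → ℕ) : ℝ :=
  ∏ i, (1 : ℝ) / (m i : ℝ) ^ (k.get i : ℕ)

theorem sum_tuples_cons (N lo : ℕ) (hlo : lo + 1 ≤ N) (a : ℕ+) (u : List ℕ+) :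
    ∑ m ∈ tuples N lo (a :: u).length, term (a :: u) m
      = ∑ m ∈ tuples N (lo + 1) (a :: u).length, term (a :: u) m
        + (1 / ((lo + 1 : ℕ) : ℝ) ^ (a : ℕ)) * ∑ m ∈ tuples N (lo + 1) u.length, term u m := by
  classical
  have hz : ∀ m : Fin (u.length + 1) → ℕ, StrictMono m → ∀ i, m 0 ≤ m i :=
    fun m hm i => hm.monotone (Fin.zero_le i)
  rw [← Finset.sum_filter_add_sum_filter_not (tuples N lo (a :: u).length)
    (fun m : Fin (u.length + 1) → ℕ => m 0 ≠ lo + 1), Finset.mul_sum]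
  congr 1
  · apply Finset.sum_congr _ fun _ _ => rfl
    ext m
    change Fin (u.length + 1) → ℕ at m
    rw [Finset.mem_filter, mem_tuples, mem_tuples]
    constructor
    · rintro ⟨⟨h1, h2, h3⟩, h4⟩
      refine ⟨h1, h2, fun i => ?_⟩
      have e1 := h3 (0 : Fin (u.length + 1))
      have e2 := hz m h2 i
      omega
    · rintro ⟨h1, h2, h3⟩
      refine ⟨⟨h1, h2, fun i => (Nat.lt_succ_self lo).trans (h3 i)⟩, ?_⟩
      exact (h3 (0 : Fin (u.length + 1))).ne'
  · symm
    refine Finset.sum_bij' (fun (m : Fin u.length → ℕ) _ => (Fin.cons (lo + 1) m : Fin (u.length + 1) → ℕ))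
      (fun (m : Fin (u.length + 1) → ℕ) _ => Fin.tail m) ?_ ?_ ?_ ?_ ?_
    · intro m hm
      rw [mem_tuples] at hm
      obtain ⟨h1, h2, h3⟩ := hm
      rw [Finset.mem_filter, mem_tuples]
      refine ⟨⟨?_, ?_, ?_⟩, ?_⟩
      · intro i
        refine Fin.cases ?_ (fun i => ?_) i
        · simpa using hlo
        · simpa using h1 i
      · rw [Fin.strictMono_iff_lt_succ]
        intro i
        rcases i with ⟨_ | i, hi⟩
        · exact h3 ⟨0, hi⟩
        · exact h2 (show (⟨i, _⟩ : Fin u.length) < ⟨i + 1, hi⟩ from Fin.mk_lt_mk.2 (Nat.lt_succ_self i))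
      · intro i
        refine Fin.cases ?_ (fun i => ?_) i
        · simp
        · have := h3 i
          simp only [Fin.cons_succ]
          omega
      · simp
    · intro m hm
      rw [Finset.mem_filter, mem_tuples] at hm
      obtain ⟨⟨h1, h2, h3⟩, h4⟩ := hm
      rw [mem_tuples]
      have h4 : m 0 = lo + 1 := not_not.1 h4
      refine ⟨fun i => h1 i.succ, fun i j hij => h2 (Fin.succ_lt_succ_iff.2 hij), fun i => ?_⟩
      rw [← h4]
      exact h2 (Fin.succ_pos i)
    · intro m hm
      exact Fin.tail_cons _ _
    · intro m hm
      rw [Finset.mem_filter] at hm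
      have h4 : m 0 = lo + 1 := not_not.1 hm.2
      rw [← h4]
      exact Fin.cons_self_tail m
    · intro m hm
      exact (Fin.prod_univ_succ (n := u.length) fun i => (1 : ℝ) /
        ((Fin.cons (lo + 1) m : Fin (u.length + 1) → ℕ) i : ℝ) ^ ((a :: u).get i : ℕ)).symm

theorem Admissible.tail {a : ℕ+} {u : List ℕ+} (h : Admissible (a :: u)) : Admissible u := by
  rcases u with _ | ⟨b, u⟩
  · simp [Admissible]
  · simpa [Admissible, List.getLast?_cons_cons] using h

theorem Admissible.oneExp {a : ℕ+} {u : List ℕ+} (h : Admissible (a :: u)) (c : ℝ) :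
    oneExp c (a :: u) = 0 :=
  oneExp_of_mem (List.getLast_mem (List.cons_ne_nil a u))
    (h _ (List.getLast?_eq_some_getLast (List.cons_ne_nil a u)))

theorem sum_tuples_nil (N lo : ℕ) :
    ∑ m ∈ tuples N lo ([] : List ℕ+).length, term [] m = 1 := by
  have : tuples N lo 0 = Finset.univ := by
    ext m
    rw [mem_tuples]
    exact ⟨fun _ => Finset.mem_univ _, fun _ => ⟨fun i => i.elim0, fun i => i.elim0,
      fun i => i.elim0⟩⟩
  change ∑ m ∈ tuples N lo 0, term [] m = 1
  rw [this]
  exact (Fintype.sum_unique (ι := Fin 0 → ℕ) _).trans (Fin.prod_univ_zero _)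

theorem trunc_eq (c : ℝ) (N r : ℕ) (hr : r ≤ N) (k : List ℕ+) (hk : Admissible k) :
    trunc (oneExp c) N r k = ∑ m ∈ tuples N (N - r) k.length, term k m := by
  induction r generalizing k with
  | zero =>
    rcases k with _ | ⟨a, u⟩
    · rw [sum_tuples_nil]
      simp [trunc, MZV.oneExp]
    · have : tuples N (N - 0) (a :: u).length = ∅ := by
        rw [Finset.eq_empty_iff_forall_notMem]
        intro m hm
        rw [mem_tuples] at hm
        have h1 := hm.1 (0 : Fin (u.length + 1))
        have h2 := hm.2.2 (0 : Fin (u.length + 1))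
        omega
      rw [this, Finset.sum_empty]
      exact hk.oneExp c
  | succ r ih =>
    rcases k with _ | ⟨a, u⟩
    · rw [trunc, ih (by omega) [] hk]
      rw [sum_tuples_nil, sum_tuples_nil]
    · rw [trunc, ih (by omega) _ hk, ih (by omega) u hk.tail]
      have e := sum_tuples_cons N (N - (r + 1)) (by omega) a u
      rw [show N - (r + 1) + 1 = N - r by omega] at e
      exact e.symm

theorem term_nonneg (k : List ℕ+) (m : Fin k.length → ℕ) : 0 ≤ term k m :=
  Finset.prod_nonneg fun i _ => by positivity

theorem term_le {k : List ℕ+} (hk : Admissible k) (hk0 : k ≠ []) {m : Fin k.length → ℕ}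
    (hm : StrictMono m) (hpos : ∀ i, 0 < m i) :
    term k m ≤ ∏ i, 1 / (m i : ℝ) ^ (1 + 1 / (k.length : ℝ)) := by
  have hd : 0 < k.length := List.length_pos_iff.2 hk0
  let l : Fin k.length := ⟨k.length - 1, by omega⟩
  have hl : ∀ i, m i ≤ m l := fun i => hm.monotone (Fin.mk_le_mk.2 (by omega) : i ≤ ⟨k.length - 1, _⟩)
  have hkl : 2 ≤ (k.get l : ℕ) := by
    have h1 : k.get l ≠ 1 := by
      apply hk
      rw [List.getLast?_eq_getElem?]
      exact (List.getElem?_eq_getElem l.2)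
    have h2 := (k.get l).pos
    have h3 : (k.get l : ℕ) ≠ 1 := fun h => h1 (PNat.coe_eq_one_iff.1 h)
    omega
  have hp : ∀ i, (0 : ℝ) < m i := fun i => by exact_mod_cast hpos i
  have h1 : ∀ i, (1 : ℝ) ≤ m i := fun i => by exact_mod_cast hpos i
  simp only [term, one_div, Finset.prod_inv_distrib]
  apply inv_anti₀ (Finset.prod_pos fun i _ => Real.rpow_pos_of_pos (hp i) _)
  have e1 : ∏ i, (m i : ℝ) ^ (1 + (k.length : ℝ)⁻¹) ≤ (∏ i, (m i : ℝ)) * m l := by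
    simp only [Real.rpow_add (hp _), Real.rpow_one, Finset.prod_mul_distrib]
    refine mul_le_mul_of_nonneg_left ?_ (Finset.prod_nonneg fun i _ => (hp i).le)
    calc ∏ i, (m i : ℝ) ^ (k.length : ℝ)⁻¹ ≤ ∏ _i : Fin k.length, (m l : ℝ) ^ (k.length : ℝ)⁻¹ := by
          apply Finset.prod_le_prod
          · exact fun i _ => Real.rpow_nonneg (hp i).le _
          · exact fun i _ => Real.rpow_le_rpow (hp i).le (by exact_mod_cast hl i) (by positivity)
      _ = m l := by
          rw [Finset.prod_const, Finset.card_univ, Fintype.card_fin]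
          exact Real.rpow_inv_natCast_pow (hp l).le hd.ne'
  refine e1.trans ?_
  rw [← Finset.mul_prod_erase _ _ (Finset.mem_univ l),
    ← Finset.mul_prod_erase Finset.univ (fun i => (m i : ℝ) ^ (k.get i : ℕ)) (Finset.mem_univ l),
    mul_right_comm, ← sq]
  apply mul_le_mul
  · exact pow_le_pow_right₀ (h1 l) hkl
  · apply Finset.prod_le_prod (fun i _ => (hp i).le)
    exact fun i _ => le_self_pow₀ (h1 i) (k.get i).pos.ne'
  · exact Finset.prod_nonneg fun i _ => (hp i).le
  · positivity

theorem sum_tuples_le {k : List ℕ+} (hk : Admissible k) (hk0 : k ≠ []) (N : ℕ) :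
    ∑ m ∈ tuples N 0 k.length, term k m
      ≤ (∑' n : ℕ, 1 / (n : ℝ) ^ (1 + 1 / (k.length : ℝ))) ^ k.length := by
  classical
  have hd : (0 : ℝ) < k.length := by exact_mod_cast List.length_pos_iff.2 hk0
  have hs : Summable fun n : ℕ => 1 / (n : ℝ) ^ (1 + 1 / (k.length : ℝ)) :=
    Real.summable_one_div_nat_rpow.2 (by have := one_div_pos.2 hd; linarith)
  have hsub : tuples N 0 k.length ⊆
      Fintype.piFinset fun _ : Fin k.length => Finset.range (N + 1) := by
    intro m hm
    rw [mem_tuples] at hm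
    exact Fintype.mem_piFinset.2 fun i => Finset.mem_range.2 (Nat.lt_succ_of_le (hm.1 i))
  calc ∑ m ∈ tuples N 0 k.length, term k m
      ≤ ∑ m ∈ tuples N 0 k.length, ∏ i, 1 / (m i : ℝ) ^ (1 + 1 / (k.length : ℝ)) :=
        Finset.sum_le_sum fun m hm => by
          rw [mem_tuples] at hm
          exact term_le hk hk0 hm.2.1 hm.2.2
    _ ≤ ∑ m ∈ Fintype.piFinset fun _ : Fin k.length => Finset.range (N + 1),
          ∏ i, 1 / (m i : ℝ) ^ (1 + 1 / (k.length : ℝ)) :=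
        Finset.sum_le_sum_of_subset_of_nonneg hsub fun m _ _ =>
          Finset.prod_nonneg fun i _ => by positivity
    _ = ∏ _i : Fin k.length, ∑ n ∈ Finset.range (N + 1), 1 / (n : ℝ) ^ (1 + 1 / (k.length : ℝ)) :=
        (Finset.prod_univ_sum (fun _ : Fin k.length => Finset.range (N + 1))
          fun _ n => 1 / (n : ℝ) ^ (1 + 1 / (k.length : ℝ))).symm
    _ ≤ _ := by
        rw [Finset.prod_const, Finset.card_univ, Fintype.card_fin]
        exact pow_le_pow_left₀ (Finset.sum_nonneg fun n _ => by positivity)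
          (hs.sum_le_tsum _ fun n _ => by positivity) _

theorem tendsto_trunc {k : List ℕ+} (hk : Admissible k) (c : ℕ → ℝ) :
    Filter.Tendsto (fun N => trunc (oneExp (c N)) N N k) Filter.atTop (nhds (mzv k)) := by
  classical
  let s : Set (Fin k.length → ℕ) := {m | StrictMono m ∧ ∀ i, 0 < m i}
  have hmzv : mzv k = ∑' m, s.indicator (term k) m := tsum_subtype s (term k)
  have hbox : ∀ N, trunc (oneExp (c N)) N N k =
      ∑ m ∈ Fintype.piFinset fun _ : Fin k.length => Finset.range (N + 1),
        s.indicator (term k) m := by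
    intro N
    rw [trunc_eq _ N N le_rfl k hk, Nat.sub_self, tuples, Finset.sum_filter]
    exact Finset.sum_congr rfl fun m _ => by rw [Set.indicator_apply]; rfl
  have hmono : Monotone fun N : ℕ => Fintype.piFinset fun _ : Fin k.length => Finset.range (N + 1) :=
    fun a b h => Fintype.piFinset_subset _ _ fun _ => Finset.range_mono (by omega)
  have hmem : ∀ m : Fin k.length → ℕ, ∃ N : ℕ,
      m ∈ Fintype.piFinset fun _ : Fin k.length => Finset.range (N + 1) := by
    intro m
    refine ⟨∑ i, m i, Fintype.mem_piFinset.2 fun i => Finset.mem_range.2 (Nat.lt_succ_of_le ?_)⟩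
    exact Finset.single_le_sum (f := m) (fun _ _ => Nat.zero_le _) (Finset.mem_univ i)
  have hat := Filter.tendsto_atTop_finset_of_monotone hmono hmem
  have hnn : ∀ m, 0 ≤ s.indicator (term k) m :=
    fun m => Set.indicator_nonneg (fun m _ => term_nonneg k m) m
  have hsum : Summable (s.indicator (term k)) := by
    rcases eq_or_ne k [] with rfl | hk0
    · exact Summable.of_finite (β := Fin 0 → ℕ)
    · refine summable_of_sum_le hnn (c := (∑' n : ℕ, 1 / (n : ℝ) ^ (1 + 1 / (k.length : ℝ))) ^ k.length)
        fun t => ?_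
      obtain ⟨N, hN⟩ := (hat.eventually_ge_atTop t).exists
      refine (Finset.sum_le_sum_of_subset_of_nonneg hN fun m _ _ => hnn m).trans ?_
      rw [← hbox, trunc_eq _ N N le_rfl k hk, Nat.sub_self]
      exact sum_tuples_le hk hk0 N
  simp only [hbox, hmzv]
  exact hsum.hasSum.comp hat

theorem trunc_one (c : ℝ) (N r : ℕ) :
    trunc (oneExp c) N r [1] = c + ∑ i ∈ Finset.range r, 1 / ((N - i : ℕ) : ℝ) := by
  induction r with
  | zero => simp [trunc, oneExp]
  | succ r ih =>
    have h1 : trunc (oneExp c) N r [] = 1 := (trunc_mul (by simp [oneExp]) (oneExp_mul c) N r).1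
    rw [trunc, ih, h1, Finset.sum_range_succ]
    simp [add_assoc]

theorem exists_isStuffleRegularization : ∃ Z, IsStuffleRegularization Z := by
  let c : ℕ → ℝ := fun N => -∑ i ∈ Finset.range N, 1 / ((N - i : ℕ) : ℝ)
  let A : ℕ → List ℕ+ → ℝ := fun N => trunc (oneExp (c N)) N N
  have hA : ∀ N u v, A N u * A N v = ((stuffle u v).map (A N)).sum :=
    fun N => (trunc_mul (by simp [oneExp]) (oneExp_mul (c N)) N N).2
  have hA1 : ∀ N, A N [1] = 0 := fun N => by simp only [A, trunc_one, c]; ring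
  have hsum : ∀ M : Multiset (List ℕ+), ∀ Z : List ℕ+ → ℝ,
      (∀ w ∈ M, Filter.Tendsto (fun N => A N w) Filter.atTop (nhds (Z w))) →
      Filter.Tendsto (fun N => (M.map (A N)).sum) Filter.atTop (nhds (M.map Z).sum) :=
    fun M Z h => tendsto_multiset_sum M h
  have hlim : ∀ w, ∃ z, Filter.Tendsto (fun N => A N w) Filter.atTop (nhds z) := by
    intro w
    induction w using stuffle_induction with
    | hadm k hk => exact ⟨mzv k, tendsto_trunc hk c⟩
    | hstep n u w M hu hM ih =>
      classical
      choose! Z hZ using ih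
      refine ⟨-(((n + 1 : ℕ) : ℝ)⁻¹ * (M.map Z).sum), ?_⟩
      refine ((hsum M Z hZ).const_mul ((n + 1 : ℕ) : ℝ)⁻¹).neg.congr fun N => ?_
      have e := hA N u [1]
      rw [hA1, hM, mul_zero, Multiset.map_add, Multiset.sum_add, Multiset.map_nsmul,
        Multiset.sum_nsmul, Multiset.map_singleton, Multiset.sum_singleton, nsmul_eq_mul] at e
      have hn : ((n + 1 : ℕ) : ℝ) ≠ 0 := by positivity
      rw [neg_eq_iff_eq_neg, inv_mul_eq_iff_eq_mul₀ hn]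
      linarith
  choose Z hZ using hlim
  refine ⟨Z, ⟨fun k hk => tendsto_nhds_unique (hZ k) (tendsto_trunc hk c),
    tendsto_nhds_unique (hZ [1]) (by simp [hA1]), fun u v => ?_⟩⟩
  refine tendsto_nhds_unique ((hZ u).mul (hZ v)) ?_
  simp only [hA]
  exact hsum _ Z fun w _ => hZ w

theorem existsUnique_isStuffleRegularization : ∃! Z, IsStuffleRegularization Z := by
  obtain ⟨Z, hZ⟩ := exists_isStuffleRegularization
  exact ⟨Z, hZ, fun Z' hZ' => hZ'.unique hZ⟩

/-- The stuffle regularized multiple zeta values `ζ^*(k_1, …, k_d)`: the unique extension of the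
multiple zeta values to all indices that is multiplicative for the stuffle product and
vanishes at the index `(1)`. -/
noncomputable def zetaReg : List ℕ+ → ℝ :=
  Classical.choose existsUnique_isStuffleRegularization.exists

theorem isStuffleRegularization_zetaReg : IsStuffleRegularization zetaReg :=
  Classical.choose_spec existsUnique_isStuffleRegularization.exists

/-- All indices obtained from `(a, l_1, l_2, …)` by replacing each comma by `,` or `+`. -/
def mergesCons : ℕ+ → List ℕ+ → List (List ℕ+)
  | a, [] => [[a]]
  | a, b :: l => (mergesCons b l).map (a :: ·) ++ mergesCons (a + b) l

/-- All indices obtained from an index by replacing each comma by `,` or `+`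
(the empty index gives itself only). -/
def merges : List ℕ+ → List (List ℕ+)
  | [] => [[]]
  | a :: l => mergesCons a l

/-- The stuffle regularized multiple zeta star values `ζ^{⋆,*}(k_1, …, k_d)`. -/
noncomputable def zetaStarReg (k : List ℕ+) : ℝ := ((merges k).map zetaReg).sum

/-- The index `(k_1 + a_1, …, k_d + a_d)`. -/
def shift (k : List ℕ+) (a : Fin k.length → ℕ) : List ℕ+ :=
  List.ofFn fun j => ⟨(k.get j : ℕ) + a j, Nat.add_pos_left (k.get j).pos _⟩

/-- `ζ_a^*(k_1, …, k_d) = (-1)^a ∑_{a_1 + ⋯ + a_d = a} ζ^*(k_1 + a_1, …, k_d + a_d)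
∏_j binom(k_j - 1 + a_j, a_j)`. -/
noncomputable def zetaRegCoeff (a : ℕ) (k : List ℕ+) : ℝ :=
  (-1) ^ a * ∑ e ∈ Finset.Nat.antidiagonalTuple k.length a,
    zetaReg (shift k e) * ∏ j, (((k.get j : ℕ) - 1 + e j).choose (e j) : ℝ)

/-- `δ^{k_1, …, k_d}` is `(-1)^n π^{2n} / (2n)!` if the index consists of `2n` letters `1`,
for some `n ≥ 0`, and is `0` otherwise. -/
noncomputable def delta (k : List ℕ+) : ℝ :=
  if Even k.length ∧ ∀ x ∈ k, x = 1 then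
    (-1) ^ (k.length / 2) * Real.pi ^ k.length / (k.length.factorial : ℝ)
  else 0

/-- The weight `k_1 + ⋯ + k_d`. -/
def weight (k : List ℕ+) : ℕ := (k.map fun x => (x : ℕ)).sum

/-- The triples `(a, m, b)` of natural numbers with `a + 2 m + b = n`. -/
def triples (n : ℕ) : Finset (ℕ × ℕ × ℕ) :=
  (Finset.range (n + 1) ×ˢ Finset.range (n + 1) ×ˢ Finset.range (n + 1)).filter
    fun t => t.1 + 2 * t.2.1 + t.2.2 = n

theorem mem_triples {n a m b : ℕ} : (a, m, b) ∈ triples n ↔ a + 2 * m + b = n := by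
  simp only [triples, Finset.mem_filter, Finset.mem_product, Finset.mem_range]
  omega

end MZV

open Filter Topology

namespace MZV

/-! Functions on words are treated as noncommutative generating series, multiplied by the
deconcatenation product `conv`. A truncated multiple harmonic sum is then an ordered product of
one-variable factors `letter (x m)`. Taking `x m = 1 / (m + z)` and multiplying on the right by the
exponential series of minus the harmonic number yields stuffle characters `regTrunc`. They converge
locally uniformly on `|Re z| < 3 / 4` to regularized multiple Hurwitz functions `hurwitz`, whose
Taylor coefficients at `0` are the numbers `ζ_a^*` (`hasSum_hurwitz`).

The relation comes from the multitangent function, the regularized sum of `∏ (z + m_i)^{-k_i}` over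
all integers `m_1 > ⋯ > m_d`. Splitting by the sign of the `m_i` factors it as `posSum`, `letter
z⁻¹`, `negSum`. A shift of `z` by `1` only moves a factor from one side to the other, so the
function has period `1` (`multitangent_sub_one`). In the strip its only possible pole is `0`. The
principal part there is cancelled by a combination of monotangent functions, whose coefficients are
Taylor coefficients of products of `posSum` and `negSum`. The difference extends to a bounded entire
function, hence is constant by `eq_of_periodic_of_bounded`. Its limits at `±i∞` are governed by
`(∓πi)^d / d!` on the words `1 ⋯ 1`. In their mean the monotangent contributions cancel, and `δ`
remains. Equating this mean with the value at `0` is `multitangent_reduction`. The constant terms of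
the monotangent functions are `0` or `2ζ(2m)`, which brings in the Bernoulli numbers
(`bernoulliSum_eq`).

At `z = 0` the two outer factors are `ζ^*` of the reversed word and `(-1)^{weight} ζ^*`. By the
antipode relation `conv_star_zetaReg`, the signed star values are the left convolution inverse of
the former. Convolving the reduction with them isolates `ζ^*(k)`, and the term `i = d` of the `δ`
sum is the star value on the left of the theorem. -/

theorem weight_nil : weight [] = 0 := rfl

theorem weight_cons (a : ℕ+) (w : List ℕ+) : weight (a :: w) = a + weight w := by
  simp [weight]

theorem weight_append (u v : List ℕ+) : weight (u ++ v) = weight u + weight v := by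
  simp [weight]

theorem weight_reverse (w : List ℕ+) : weight w.reverse = weight w := by
  induction w with
  | nil => rfl
  | cons a w ih => rw [List.reverse_cons, weight_append, ih, weight_cons, weight_cons, weight_nil]; ring

theorem weight_replicate (n : ℕ) : weight (List.replicate n 1) = n := by
  induction n with
  | zero => rfl
  | succ n ih => rw [List.replicate_succ, weight_cons, ih, PNat.one_coe, add_comm]

/-! ### The deconcatenation product, stuffle characters and the antipode -/

section Convolution

variable {R : Type*} [CommRing R]

/-- The convolution of two functions on words with respect to deconcatenation. -/
def conv (f g : List ℕ+ → R) (w : List ℕ+) : R :=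
  ∑ i ∈ Finset.range (w.length + 1), f (w.take i) * g (w.drop i)

/-- The unit of the convolution. -/
def unitWord (w : List ℕ+) : R := if w = [] then 1 else 0

/-- The function with value `1` at the empty word, `x ^ a` at the word `(a)` and `0` at the
longer words. -/
def letter (x : R) : List ℕ+ → R
  | [] => 1
  | [a] => x ^ (a : ℕ)
  | _ :: _ :: _ => 0

theorem conv_nil (f g : List ℕ+ → R) : conv f g [] = f [] * g [] := by simp [conv]

theorem conv_cons (f g : List ℕ+ → R) (a : ℕ+) (w : List ℕ+) :
    conv f g (a :: w) = f [] * g (a :: w) + conv (fun u => f (a :: u)) g w := by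
  rw [conv, List.length_cons, Finset.sum_range_succ', add_comm]
  simp [conv]

theorem conv_add_left (f f' g : List ℕ+ → R) (w : List ℕ+) :
    conv (fun u => f u + f' u) g w = conv f g w + conv f' g w := by
  simp [conv, add_mul, Finset.sum_add_distrib]

theorem conv_mul_left (c : R) (f g : List ℕ+ → R) (w : List ℕ+) :
    conv (fun u => c * f u) g w = c * conv f g w := by
  simp [conv, mul_assoc, Finset.mul_sum]

theorem conv_sub_right (f g g' : List ℕ+ → R) (w : List ℕ+) :
    conv f (fun u => g u - g' u) w = conv f g w - conv f g' w := by
  simp [conv, mul_sub, Finset.sum_sub_distrib]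

theorem conv_assoc (f g h : List ℕ+ → R) : conv (conv f g) h = conv f (conv g h) := by
  funext w
  induction w generalizing f with
  | nil => simp only [conv_nil, mul_assoc]
  | cons a w ih =>
    rw [conv_cons, conv_cons f, conv_cons g, conv_nil]
    simp only [conv_cons f g]
    rw [conv_add_left, conv_mul_left, ← ih]
    ring

theorem conv_unit_left (f : List ℕ+ → R) : conv unitWord f = f := by
  funext w
  cases w with
  | nil => simp [conv_nil, unitWord]
  | cons a w => simp [unitWord, conv]

theorem conv_unit_right (f : List ℕ+ → R) : conv f unitWord = f := by
  funext w
  induction w generalizing f with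
  | nil => simp [conv_nil, unitWord]
  | cons a w ih => rw [conv_cons, ih]; simp [unitWord]

/-- This is the effect of adding one new smallest summation index: either it is not used, or it
carries the first letter. -/
theorem conv_letter_cons (x : R) (f : List ℕ+ → R) (a : ℕ+) (w : List ℕ+) :
    conv (letter x) f (a :: w) = f (a :: w) + x ^ (a : ℕ) * f w := by
  have h : (fun u => letter x (a :: u)) = fun u => x ^ (a : ℕ) * (unitWord u : R) := by
    funext u
    cases u <;> simp [letter, unitWord]
  rw [conv_cons, h, conv_mul_left, conv_unit_left, letter, one_mul]

theorem conv_letter_nil (x : R) (f : List ℕ+ → R) : conv (letter x) f [] = f [] := by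
  rw [conv_nil, letter, one_mul]

/-- Reversal is an anti-automorphism of the convolution; it exchanges increasing and decreasing
summation indices. -/
theorem conv_reverse (f g : List ℕ+ → R) (w : List ℕ+) :
    conv f g w.reverse = conv (fun u => g u.reverse) (fun u => f u.reverse) w := by
  rw [conv, conv, List.length_reverse, ← Finset.sum_range_reflect]
  refine Finset.sum_congr rfl fun i hi => ?_
  have hi := Finset.mem_range.1 hi
  rw [List.take_reverse, List.drop_reverse, mul_comm]
  congr 4 <;> omega

theorem letter_reverse (x : R) (w : List ℕ+) : letter x w.reverse = letter x w := by
  rcases w with _ | ⟨a, _ | ⟨b, w⟩⟩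
  · rfl
  · rfl
  · generalize h : (a :: b :: w).reverse = v
    have hl := congrArg List.length h
    rcases v with _ | ⟨c, _ | ⟨d, v⟩⟩
    · simp at hl
    · simp at hl
    · rfl

theorem conv_append_singleton_letter (f : List ℕ+ → R) (x : R) (w : List ℕ+) (a : ℕ+) :
    conv f (letter x) (w ++ [a]) = f (w ++ [a]) + f w * x ^ (a : ℕ) := by
  have h := conv_reverse f (letter x) (a :: w.reverse)
  simp only [letter_reverse, List.reverse_cons, List.reverse_reverse] at h
  rw [h, conv_letter_cons]
  simp [mul_comm]

/-- Inserting one letter into a convolution. -/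
theorem conv_conv_letter (f g : List ℕ+ → R) (x : R) (w : List ℕ+) :
    conv f (conv (letter x) g) w = conv f g w + ∑ j : Fin w.length,
      x ^ (w.get j : ℕ) * (f (w.take j) * g (w.drop ((j : ℕ) + 1))) := by
  induction w generalizing f with
  | nil => simp [conv_nil, letter]
  | cons a w ih =>
    rw [conv_cons, ih, conv_letter_cons, conv_cons f g]
    rw [show ∑ j : Fin (a :: w).length, x ^ ((a :: w).get j : ℕ) *
        (f ((a :: w).take j) * g ((a :: w).drop ((j : ℕ) + 1))) = _ from
      Fin.sum_univ_succ (n := w.length) _]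
    simp
    ring

/-- A function on words that is multiplicative for the stuffle product. -/
structure IsChar (f : List ℕ+ → R) : Prop where
  nil : f [] = 1
  mul : ∀ u v, f u * f v = ((stuffle u v).map f).sum

/-- The contraction term of the stuffle product supplies exactly the product `x ^ a * x ^ b = x ^ (a
+ b)` that occurs when both words use the new index. -/
theorem IsChar.conv_letter {f : List ℕ+ → R} (hf : IsChar f) (x : R) :
    IsChar (conv (letter x) f) := by
  have e0 : conv (letter x) f [] = 1 := by rw [conv_letter_nil, hf.nil]
  refine ⟨e0, ?_⟩
  rintro (_ | ⟨a, u⟩) v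
  · simp [stuffle, e0]
  rcases v with _ | ⟨b, v⟩
  · simp [stuffle, e0]
  have h1 := hf.mul (a :: u) (b :: v)
  have h2 := hf.mul u (b :: v)
  have h3 := hf.mul (a :: u) v
  have h4 := hf.mul u v
  simp only [stuffle_cons_cons, Multiset.map_add, Multiset.sum_add, Multiset.map_map,
    Function.comp_def, conv_letter_cons, Multiset.sum_map_add, Multiset.sum_map_mul_left] at h1 ⊢
  have e : ∀ s : Multiset (List ℕ+), (s.map fun w => f w).sum = (s.map f).sum := fun s => rfl
  rw [e, e, e, ← h2, ← h3, ← h4, PNat.add_coe, pow_add]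
  linear_combination h1

/-- The truncated multiple harmonic sums with `1 / m` replaced by `x m`. -/
def harm (x : ℕ → R) : ℕ → List ℕ+ → R
  | 0 => unitWord
  | N + 1 => conv (harm x N) (letter (x (N + 1)))

/-- A truncated sum is a product of factors `letter`, so a property need only survive left
convolution by one of them. -/
theorem conv_harm_induction {C : (List ℕ+ → R) → Prop}
    (hC : ∀ x f, C f → C (conv (letter x) f)) (x : ℕ → R) (N : ℕ) (f : List ℕ+ → R) (hf : C f) :
    C (conv (harm x N) f) := by
  induction N generalizing f with
  | zero => rwa [harm, conv_unit_left]
  | succ N ih => rw [harm, conv_assoc]; exact ih _ (hC _ _ hf)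

theorem harm_shift (x y : ℕ → R) (h : ∀ n, 0 < n → x (n + 1) = y n) (N : ℕ) :
    harm x (N + 1) = conv (letter (x 1)) (harm y N) := by
  induction N with
  | zero => rw [harm, harm, harm, conv_unit_left, conv_unit_right]
  | succ N ih => rw [harm, ih, conv_assoc, harm, h _ N.succ_pos]

theorem harm_nil (x : ℕ → R) (N : ℕ) : harm x N [] = 1 := by
  induction N with
  | zero => simp [harm, unitWord]
  | succ N ih => rw [harm, conv_nil, ih, letter, one_mul]

theorem harm_append_singleton (x : ℕ → R) (N : ℕ) (w : List ℕ+) (a : ℕ+) :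
    harm x N (w ++ [a]) = ∑ n ∈ Finset.range N, harm x n w * x (n + 1) ^ (a : ℕ) := by
  induction N with
  | zero => simp [harm, unitWord]
  | succ N ih => rw [harm, conv_append_singleton_letter, ih, Finset.sum_range_succ]

/-- The sum over all words obtained by replacing each comma by `,` or `+`, with the sign
`(-1) ^ d`. -/
def star (f : List ℕ+ → R) (w : List ℕ+) : R := (-1) ^ w.length * ((merges w).map f).sum

/-- When the new index carries the first letter of a merged word, that letter comes from a prefix `a
:: u` and contributes `x` to the weight of this prefix; what follows is an arbitrary merge of the
remaining word. -/
theorem sum_mergesCons_conv_letter (x : R) (f : List ℕ+ → R) (a : ℕ+) (w : List ℕ+) :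
    ((mergesCons a w).map (conv (letter x) f)).sum = ((mergesCons a w).map f).sum
      + x ^ (a : ℕ) * conv (fun u => x ^ weight u) (fun v => ((merges v).map f).sum) w := by
  induction w generalizing f a with
  | nil => simp [mergesCons, conv_letter_cons, conv_nil, weight, merges]
  | cons b w ih =>
    simp only [mergesCons, List.map_append, List.sum_append, List.map_map, Function.comp_def, ih]
    simp only [conv_letter_cons, List.sum_map_add, List.sum_map_mul_left]
    rw [conv_cons]
    have e : (fun u : List ℕ+ => x ^ weight (b :: u))
        = fun u => x ^ (b : ℕ) * x ^ weight u := by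
      funext u; rw [weight_cons, pow_add]
    rw [e, conv_mul_left, PNat.add_coe, pow_add]
    simp [weight, merges]
    ring

/-- In a star sum the inequalities are weak, so one index may carry a whole block of letters; the
factor `letter x` therefore turns into a signed geometric series. -/
theorem star_conv_letter (x : R) (f : List ℕ+ → R) :
    star (conv (letter x) f)
      = conv (fun u => (-1) ^ u.length * x ^ weight u) (star f) := by
  funext w
  have hs : conv (fun u => (-1) ^ u.length * x ^ weight u) (star f) w
      = (-1) ^ w.length * conv (fun u => x ^ weight u) (fun v => ((merges v).map f).sum) w := by
    rw [conv, conv, Finset.mul_sum]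
    refine Finset.sum_congr rfl fun i _ => ?_
    have : (-1 : R) ^ w.length = (-1) ^ (w.take i).length * (-1) ^ (w.drop i).length := by
      rw [← pow_add, ← List.length_append, List.take_append_drop]
    rw [star, this]
    ring
  rw [hs, star]
  congr 1
  rcases w with _ | ⟨a, w⟩
  · simp [merges, conv_nil, weight, letter]
  · rw [conv_cons, merges, sum_mergesCons_conv_letter]
    have e : (fun u : List ℕ+ => x ^ weight (a :: u))
        = fun u => x ^ (a : ℕ) * x ^ weight u := by
      funext u; rw [weight_cons, pow_add]
    rw [e, conv_mul_left]
    simp [weight, merges]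

/-- Only the last letter can be split off by `letter x`, and the two resulting terms differ by a
sign: the geometric series is the inverse of `letter x`. -/
theorem conv_geom_letter (x : R) :
    conv (fun u => (-1) ^ u.length * x ^ weight u) (letter x) = unitWord := by
  funext w
  rcases w.eq_nil_or_concat with rfl | ⟨w, a, rfl⟩
  · simp [conv_nil, weight, letter, unitWord]
  · rw [List.concat_eq_append, conv_append_singleton_letter]
    simp [weight_append, weight_cons, weight_nil, unitWord, pow_succ, pow_add]
    ring

/-- The new factors appear on the two outer sides of the product, so the relation for `f` collapses
the middle and `conv_geom_letter` cancels the rest. -/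
theorem star_antipode_conv_letter (x : R) (f : List ℕ+ → R)
    (hf : conv (star f) (fun u => f u.reverse) = unitWord) :
    conv (star (conv (letter x) f)) (fun u => conv (letter x) f u.reverse) = unitWord := by
  have e : (fun u : List ℕ+ => conv (letter x) f u.reverse)
      = conv (fun u => f u.reverse) (letter x) := by
    funext u
    rw [conv_reverse]
    simp only [letter_reverse]
  rw [e, star_conv_letter, ← conv_assoc, conv_assoc _ (star f), hf, conv_unit_right,
    conv_geom_letter]

end Convolution

/-! ### Exponential characters supported on the words `1 ⋯ 1` -/

theorem weight_stuffle (u v : List ℕ+) : ∀ w ∈ stuffle u v, weight w = weight u + weight v := by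
  induction u, v using stuffle.induct with
  | case1 v => simp [stuffle, weight]
  | case2 a u => simp [stuffle, weight]
  | case3 a u b v ih1 ih2 ih3 =>
    intro w hw
    rw [stuffle_cons_cons, Multiset.mem_add, Multiset.mem_add] at hw
    rcases hw with (hw | hw) | hw <;> obtain ⟨w', hw', rfl⟩ := Multiset.mem_map.1 hw
    · have := ih1 w' hw'
      simp only [weight_cons] at this ⊢
      omega
    · have := ih2 w' hw'
      simp only [weight_cons] at this ⊢
      omega
    · have := ih3 w' hw'
      simp only [weight_cons, PNat.add_coe] at this ⊢
      omega

/-- The complex version of `oneExp`. -/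
noncomputable def oneExpC (c : ℂ) (w : List ℕ+) : ℂ := c ^ weight w * (oneExp 1 w : ℂ)

theorem oneExpC_nil (c : ℂ) : oneExpC c [] = 1 := by simp [oneExpC, oneExp, weight]

theorem oneExpC_of_mem {c : ℂ} {w : List ℕ+} {x : ℕ+} (h : x ∈ w) (hx : x ≠ 1) :
    oneExpC c w = 0 := by rw [oneExpC, oneExp_of_mem h hx]; simp

theorem oneExpC_replicate (c : ℂ) (n : ℕ) :
    oneExpC c (List.replicate n 1) = c ^ n / (n.factorial : ℂ) := by
  rw [oneExpC, oneExp_replicate]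
  simp [weight_replicate, div_eq_mul_inv]

/-- The stuffle product is homogeneous for the weight, so scaling the real character `oneExp 1` by
`c ^ weight` keeps it multiplicative. -/
theorem isChar_oneExpC (c : ℂ) : IsChar (oneExpC c) := by
  refine ⟨oneExpC_nil c, fun u v => ?_⟩
  have h : (stuffle u v).map (oneExpC c) =
      (stuffle u v).map fun w => c ^ (weight u + weight v) * (oneExp 1 w : ℂ) :=
    Multiset.map_congr rfl fun w hw => by rw [oneExpC, weight_stuffle u v w hw]
  have h2 := congrArg (fun x : ℝ => (x : ℂ)) (oneExp_mul 1 u v)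
  simp only [Complex.ofReal_mul] at h2
  rw [h, Multiset.sum_map_mul_left, oneExpC, oneExpC, pow_add]
  have e : ((((stuffle u v).map (oneExp 1)).sum : ℝ) : ℂ)
      = ((stuffle u v).map fun w => (oneExp 1 w : ℂ)).sum := by
    rw [← Complex.ofRealHom_eq_coe, map_multiset_sum, Multiset.map_map]; rfl
  rw [← e, ← h2]
  ring

theorem ofReal_oneExp (c : ℝ) (w : List ℕ+) : ((oneExp c w : ℝ) : ℂ) = oneExpC c w := by
  by_cases h : ∀ x ∈ w, x = 1
  · rw [List.eq_replicate_of_mem h, oneExpC_replicate, oneExp_replicate]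
    push_cast
    rfl
  · push Not at h
    obtain ⟨x, hx, hx1⟩ := h
    rw [oneExp_of_mem hx hx1, oneExpC_of_mem hx hx1, Complex.ofReal_zero]

/-- On `1 ⋯ 1` this is the binomial theorem; any other word has a letter `≠ 1` in one of the two
parts of each cut. -/
theorem conv_oneExpC (a b : ℂ) : conv (oneExpC a) (oneExpC b) = oneExpC (a + b) := by
  funext w
  by_cases h : ∀ x ∈ w, x = 1
  · rw [List.eq_replicate_of_mem h, oneExpC_replicate]
    generalize w.length = n
    rw [conv, List.length_replicate, add_pow, Finset.sum_div]
    refine Finset.sum_congr rfl fun i hi => ?_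
    have hi : i ≤ n := Nat.lt_succ_iff.1 (Finset.mem_range.1 hi)
    rw [List.take_replicate, List.drop_replicate, oneExpC_replicate, oneExpC_replicate,
      min_eq_left hi, Nat.cast_choose ℂ hi]
    have h1 := Nat.cast_ne_zero (R := ℂ).2 (Nat.factorial_ne_zero n)
    have h2 := Nat.cast_ne_zero (R := ℂ).2 (Nat.factorial_ne_zero i)
    have h3 := Nat.cast_ne_zero (R := ℂ).2 (Nat.factorial_ne_zero (n - i))
    field_simp
  · push Not at h
    obtain ⟨x, hx, hx1⟩ := h
    rw [oneExpC_of_mem hx hx1, conv]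
    refine Finset.sum_eq_zero fun i _ => ?_
    rw [← List.take_append_drop i w, List.mem_append] at hx
    rcases hx with hx | hx
    · rw [oneExpC_of_mem hx hx1, zero_mul]
    · rw [oneExpC_of_mem hx hx1, mul_zero]

theorem oneExpC_reverse (c : ℂ) (w : List ℕ+) : oneExpC c w.reverse = oneExpC c w := by
  rw [oneExpC, oneExpC, weight_reverse]
  simp [oneExp]

/-- Every genuine merge creates a letter `≥ 2`, where the exponential vanishes. The prefix `v` is
there for the induction. -/
theorem sum_mergesCons_oneExpC (c : ℂ) (a : ℕ+) (w v : List ℕ+) :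
    ((mergesCons a w).map fun u => oneExpC c (v ++ u)).sum = oneExpC c (v ++ a :: w) := by
  induction w generalizing a v with
  | nil => simp [mergesCons]
  | cons b w ih =>
    simp only [mergesCons, List.map_append, List.sum_append, List.map_map, Function.comp_def, ih]
    have := ih b (v ++ [a])
    simp only [List.append_assoc, List.singleton_append] at this
    rw [this, oneExpC_of_mem (x := a + b) (List.mem_append_right _ List.mem_cons_self)
      (pnat_add_ne_one a b), add_zero]

theorem star_oneExpC (c : ℂ) : star (oneExpC c) = oneExpC (-c) := by
  funext w
  have h : ((merges w).map (oneExpC c)).sum = oneExpC c w := by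
    rcases w with _ | ⟨a, w⟩
    · simp [merges]
    · exact sum_mergesCons_oneExpC c a w []
  rw [star, h]
  by_cases h : ∀ x ∈ w, x = 1
  · rw [List.eq_replicate_of_mem h, oneExpC_replicate, oneExpC_replicate, List.length_replicate,
      neg_pow c]
    ring
  · push Not at h
    obtain ⟨x, hx, hx1⟩ := h
    rw [oneExpC_of_mem hx hx1, oneExpC_of_mem hx hx1, mul_zero]

theorem star_antipode_oneExpC (c : ℂ) :
    conv (star (oneExpC c)) (fun u => oneExpC c u.reverse) = unitWord := by
  simp only [oneExpC_reverse]
  rw [star_oneExpC, show (fun u => oneExpC c u) = oneExpC c from rfl, conv_oneExpC]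
  funext w
  rcases w with _ | ⟨a, w⟩
  · simp [oneExpC_nil, unitWord]
  · have := a.pos
    simp [oneExpC, weight_cons, unitWord]

/-! ### Estimates for harmonic sums on the strip -/

/-- The strip `|Re z| < 3 / 4`. -/
def strip : Set ℂ := {z | |z.re| < 3 / 4}

theorem isOpen_strip : IsOpen strip :=
  isOpen_lt (Complex.continuous_re.abs) continuous_const

theorem neg_mem_strip {z : ℂ} (hz : z ∈ strip) : -z ∈ strip := by
  simpa [strip] using hz

theorem zero_mem_strip : (0 : ℂ) ∈ strip := by norm_num [strip]

/-- The summand `1 / (n + z)`. -/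
noncomputable def recip (z : ℂ) (n : ℕ) : ℂ := ((n : ℂ) + z)⁻¹

/-- The real part is at least `n + 1 - 3 / 4`. A half-width between `1 / 2` and `1` makes the strip
overlap its translate by `1` while keeping nonzero integers outside. -/
theorem le_norm_natCast_add {z : ℂ} (hz : z ∈ strip) (n : ℕ) :
    ((n : ℝ) + 1) / 4 ≤ ‖((n + 1 : ℕ) : ℂ) + z‖ := by
  refine le_trans ?_ ((le_abs_self _).trans (Complex.abs_re_le_norm _))
  have := (abs_lt.1 (show |z.re| < 3 / 4 from hz)).1
  have hn : (0 : ℝ) ≤ n := n.cast_nonneg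
  rw [Complex.add_re, Complex.natCast_re]
  push_cast
  linarith

theorem natCast_add_ne_zero {z : ℂ} (hz : z ∈ strip) (n : ℕ) : ((n + 1 : ℕ) : ℂ) + z ≠ 0 := by
  rw [← norm_pos_iff]
  exact lt_of_lt_of_le (by positivity) (le_norm_natCast_add hz n)

theorem norm_recip_le {z : ℂ} (hz : z ∈ strip) (n : ℕ) :
    ‖recip z (n + 1)‖ ≤ 4 * ((n : ℝ) + 1)⁻¹ := by
  rw [recip, norm_inv]
  refine (inv_anti₀ (by positivity) (le_norm_natCast_add hz n)).trans_eq ?_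
  rw [inv_div]; rfl

theorem norm_recip_le_im {z : ℂ} (hz : z ∈ strip) (n : ℕ) :
    ‖recip z (n + 1)‖ ≤ 4 * (max 1 |z.im|)⁻¹ := by
  rcases le_total |z.im| 1 with h | h
  · rw [max_eq_left h]
    refine (norm_recip_le hz n).trans ?_
    have : ((n : ℝ) + 1)⁻¹ ≤ 1⁻¹ := inv_anti₀ one_pos (by linarith [n.cast_nonneg (α := ℝ)])
    linarith
  · rw [max_eq_right h, recip, norm_inv]
    have h1 : |z.im| ≤ ‖((n + 1 : ℕ) : ℂ) + z‖ := by
      simpa using Complex.abs_im_le_norm (((n + 1 : ℕ) : ℂ) + z)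
    have h2 := inv_anti₀ (by linarith) h1
    have h3 : 0 ≤ |z.im|⁻¹ := by positivity
    linarith

/-- Interpolation between the two bounds of `1 / (n + z)`. -/
theorem norm_recip_le_rpow {z : ℂ} (hz : z ∈ strip) (n : ℕ) {s : ℝ} (hs0 : 0 ≤ s) (hs1 : s ≤ 1) :
    ‖recip z (n + 1)‖ ≤ 4 * (((n : ℝ) + 1) ^ (-(1 - s)) * (max 1 |z.im|) ^ (-s)) := by
  have hY : (0 : ℝ) < max 1 |z.im| := lt_of_lt_of_le one_pos (le_max_left _ _)
  have hn : (0 : ℝ) < (n : ℝ) + 1 := by positivity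
  have h0 := norm_nonneg (recip z (n + 1))
  calc ‖recip z (n + 1)‖ = ‖recip z (n + 1)‖ ^ (1 - s) * ‖recip z (n + 1)‖ ^ s := by
        rw [← Real.rpow_add_of_nonneg h0 (by linarith) hs0]; simp
    _ ≤ (4 * ((n : ℝ) + 1)⁻¹) ^ (1 - s) * (4 * (max 1 |z.im|)⁻¹) ^ s := by
        refine mul_le_mul ?_ ?_ (by positivity) (by positivity)
        · exact Real.rpow_le_rpow h0 (norm_recip_le hz n) (by linarith)
        · exact Real.rpow_le_rpow h0 (norm_recip_le_im hz n) hs0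
    _ = _ := by
        rw [Real.mul_rpow (by norm_num) (by positivity), Real.mul_rpow (by norm_num) (by positivity),
          Real.inv_rpow hn.le, Real.inv_rpow hY.le, ← Real.rpow_neg hn.le, ← Real.rpow_neg hY.le]
        have : (4 : ℝ) ^ (1 - s) * 4 ^ s = 4 := by
          rw [← Real.rpow_add (by norm_num)]; simp
        linear_combination (((n : ℝ) + 1) ^ (-(1 - s)) * (max 1 |z.im|) ^ (-s)) * this

/-- The harmonic numbers. -/
noncomputable def hsum (N : ℕ) : ℝ := ∑ n ∈ Finset.range N, ((n : ℝ) + 1)⁻¹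

theorem hsum_nonneg (N : ℕ) : 0 ≤ hsum N := Finset.sum_nonneg fun n _ => by positivity

theorem hsum_mono : Monotone hsum := fun _ _ h =>
  Finset.sum_le_sum_of_subset_of_nonneg (Finset.range_mono h) fun n _ _ => by positivity

theorem hsum_succ (N : ℕ) : hsum (N + 1) = hsum N + ((N : ℝ) + 1)⁻¹ := Finset.sum_range_succ _ _

theorem hsum_le (N : ℕ) {s : ℝ} (hs : 0 < s) : hsum N ≤ (1 + 1 / s) * ((N : ℝ) + 1) ^ s := by
  have h1 : hsum N ≤ 1 + Real.log N := by
    convert harmonic_le_one_add_log N using 1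
    simp [hsum, harmonic]
  have hN : (1 : ℝ) ≤ (N : ℝ) + 1 := by linarith [N.cast_nonneg (α := ℝ)]
  have h2 : Real.log N ≤ Real.log ((N : ℝ) + 1) := by
    rcases N.eq_zero_or_pos with rfl | h
    · simp
    · exact Real.log_le_log (by exact_mod_cast h) (by linarith)
  have h3 := Real.log_le_rpow_div (x := (N : ℝ) + 1) (by linarith) hs
  have h4 := Real.one_le_rpow hN hs.le
  rw [add_mul, one_div_mul_eq_div]
  linarith

/-- Powers of a logarithm are absorbed by a small power: exponent `1 / (4 (p + 1))` for `hsum`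
leaves at most `1 / 4` after raising to the power `p`. -/
theorem exists_hsum_pow_le (p : ℕ) : ∃ C, 0 ≤ C ∧
    ∀ N : ℕ, hsum N ^ p ≤ C * ((N : ℝ) + 1) ^ (1 / 4 : ℝ) := by
  have hs : (0 : ℝ) < 1 / (4 * (p + 1)) := by positivity
  refine ⟨(1 + 1 / (1 / (4 * ((p : ℝ) + 1)))) ^ p, by positivity, fun N => ?_⟩
  refine (pow_le_pow_left₀ (hsum_nonneg N) (hsum_le N hs) p).trans ?_
  rw [mul_pow]
  refine mul_le_mul_of_nonneg_left ?_ (by positivity)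
  rw [← Real.rpow_mul_natCast (by positivity)]
  refine Real.rpow_le_rpow_of_exponent_le (by linarith [N.cast_nonneg (α := ℝ)]) ?_
  rw [one_div_mul_eq_div, div_le_div_iff₀ (by positivity) (by norm_num)]
  nlinarith

theorem norm_harm_le {z : ℂ} (hz : z ∈ strip) (N : ℕ) (w : List ℕ+) :
    ‖harm (recip z) N w‖ ≤ 4 ^ weight w * hsum N ^ w.length := by
  induction w using List.reverseRecOn generalizing N with
  | nil => simp [harm_nil, weight_nil]
  | append_singleton w a ih =>
    rw [harm_append_singleton, weight_append, weight_cons, weight_nil, add_zero, List.length_append,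
      List.length_singleton, pow_succ, hsum, Finset.mul_sum, ← hsum, Finset.mul_sum]
    refine norm_sum_le_of_le _ fun n hn => ?_
    have hn := (Finset.mem_range.1 hn).le
    rw [norm_mul, norm_pow, pow_add]
    have h1 : ‖recip z (n + 1)‖ ^ (a : ℕ) ≤ 4 ^ (a : ℕ) * ((n : ℝ) + 1)⁻¹ := by
      refine (pow_le_pow_left₀ (norm_nonneg _) (norm_recip_le hz n) _).trans ?_
      rw [mul_pow]
      refine mul_le_mul_of_nonneg_left ?_ (by positivity)
      refine pow_le_of_le_one (by positivity) ?_ a.pos.ne'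
      exact inv_le_one_of_one_le₀ (by linarith [n.cast_nonneg (α := ℝ)])
    have h2 : ‖harm (recip z) n w‖ ≤ 4 ^ weight w * hsum N ^ w.length :=
      (ih n).trans (mul_le_mul_of_nonneg_left
        (pow_le_pow_left₀ (hsum_nonneg n) (hsum_mono hn) _) (by positivity))
    refine (mul_le_mul h2 h1 (by positivity)
      (mul_nonneg (by positivity) (pow_nonneg (hsum_nonneg N) _))).trans_eq (by ring)

/-- As `a ≥ 2`, one factor gives `n⁻¹` and a second one, interpolated at `s = 1 / 4`, gives
`n^{-3/4}` together with decay `|Im z|^{-1/4}`. The inner harmonic sum costs only `n^{1/4}`, which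
leaves the summable `n^{-3/2}`. -/
theorem exists_norm_harm_mul_le (u : List ℕ+) (a : ℕ+) (ha : a ≠ 1) : ∃ C, 0 ≤ C ∧
    ∀ (n : ℕ), ∀ z ∈ strip, ‖harm (recip z) n u * recip z (n + 1) ^ (a : ℕ)‖
      ≤ C * ((n : ℝ) + 1) ^ (-(3 / 2) : ℝ) * (max 1 |z.im|) ^ (-(1 / 4) : ℝ) := by
  obtain ⟨C, hC, hp⟩ := exists_hsum_pow_le u.length
  refine ⟨4 ^ weight u * C * 4 ^ (a : ℕ), by positivity, fun n z hz => ?_⟩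
  have hn : (0 : ℝ) < (n : ℝ) + 1 := by positivity
  have hY : (0 : ℝ) < max 1 |z.im| := lt_of_lt_of_le one_pos (le_max_left _ _)
  have ha2 : 2 ≤ (a : ℕ) := by
    have := a.pos
    have : (a : ℕ) ≠ 1 := fun h => ha (PNat.coe_eq_one_iff.1 h)
    omega
  obtain ⟨b, hb⟩ := Nat.exists_eq_add_of_le ha2
  have h1 : ‖recip z (n + 1)‖ ^ (a : ℕ)
      ≤ 4 ^ (a : ℕ) * (((n : ℝ) + 1) ^ (-(7 / 4) : ℝ) * (max 1 |z.im|) ^ (-(1 / 4) : ℝ)) := by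
    have e1 := norm_recip_le_rpow hz n (s := 1 / 4) (by norm_num) (by norm_num)
    have e2 := norm_recip_le hz n
    have e3 : ‖recip z (n + 1)‖ ^ b ≤ 4 ^ b := by
      refine pow_le_pow_left₀ (norm_nonneg _) (e2.trans ?_) _
      have : ((n : ℝ) + 1)⁻¹ ≤ 1 := inv_le_one_of_one_le₀ (by linarith [n.cast_nonneg (α := ℝ)])
      linarith
    have e4 := mul_le_mul (mul_le_mul e2 e1 (norm_nonneg _) (by positivity)) e3 (by positivity)
      (by positivity)
    rw [hb, pow_add, sq]
    refine e4.trans_eq ?_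
    have e5 : ((n : ℝ) + 1) ^ (-(7 / 4) : ℝ)
        = ((n : ℝ) + 1)⁻¹ * ((n : ℝ) + 1) ^ (-(1 - 1 / 4) : ℝ) := by
      rw [← Real.rpow_neg_one, ← Real.rpow_add hn]; norm_num
    rw [e5, pow_add]
    ring
  rw [norm_mul, norm_pow]
  have h2 : ‖harm (recip z) n u‖ ≤ 4 ^ weight u * (C * ((n : ℝ) + 1) ^ (1 / 4 : ℝ)) :=
    (norm_harm_le hz n u).trans (mul_le_mul_of_nonneg_left (hp n) (by positivity))
  refine (mul_le_mul h2 h1 (by positivity) (by positivity)).trans_eq ?_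
  have e6 : ((n : ℝ) + 1) ^ (-(3 / 2) : ℝ)
      = ((n : ℝ) + 1) ^ (1 / 4 : ℝ) * ((n : ℝ) + 1) ^ (-(7 / 4) : ℝ) := by
    rw [← Real.rpow_add hn]; norm_num
  rw [e6]
  ring

theorem summable_succ_rpow {s : ℝ} (hs : s < -1) : Summable fun n : ℕ => ((n : ℝ) + 1) ^ s := by
  have := (summable_nat_add_iff 1).2 (Real.summable_nat_rpow.2 hs)
  simpa using this

/-! ### Regularized multiple Hurwitz functions as limits of characters -/

/-- The truncated regularized sums. -/
noncomputable def regTrunc (N : ℕ) (z : ℂ) (w : List ℕ+) : ℂ :=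
  conv (harm (recip z) N) (oneExpC (-(hsum N : ℝ))) w

theorem isChar_regTrunc (N : ℕ) (z : ℂ) : IsChar (regTrunc N z) :=
  conv_harm_induction (fun x _ hf => hf.conv_letter x) _ _ _ (isChar_oneExpC _)

theorem star_antipode_regTrunc (N : ℕ) (z : ℂ) :
    conv (star (regTrunc N z)) (fun u => regTrunc N z u.reverse) = unitWord :=
  conv_harm_induction (C := fun f => conv (star f) (fun u => f u.reverse) = unitWord)
    (fun x f hf => star_antipode_conv_letter x f hf) _ _ _ (star_antipode_oneExpC _)

/-- Every nonempty suffix contains the last letter `a ≠ 1`, so the exponential factor contributes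
only on the empty suffix: no regularization is needed. -/
theorem regTrunc_append_singleton (N : ℕ) (z : ℂ) (u : List ℕ+) {a : ℕ+} (ha : a ≠ 1) :
    regTrunc N z (u ++ [a])
      = ∑ n ∈ Finset.range N, harm (recip z) n u * recip z (n + 1) ^ (a : ℕ) := by
  rw [← harm_append_singleton, regTrunc, conv, Finset.sum_range_succ, Finset.sum_eq_zero]
  · rw [List.take_of_length_le (by simp)]
    simp [oneExpC_nil]
  · intro i hi
    have hi := Finset.mem_range.1 hi
    rw [List.length_append, List.length_singleton] at hi
    rw [oneExpC_of_mem (x := a) _ ha, mul_zero]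
    rw [List.drop_append_of_le_length (by omega)]
    simp

theorem regTrunc_one (N : ℕ) (z : ℂ) :
    regTrunc N z [1] = ∑ n ∈ Finset.range N, (recip z (n + 1) - (((n : ℝ) + 1)⁻¹ : ℝ)) := by
  have h := harm_append_singleton (recip z) N [] 1
  have h1 := oneExpC_replicate (-(hsum N : ℝ)) 1
  simp only [List.nil_append, harm_nil, one_mul, PNat.one_coe, pow_one] at h
  simp only [List.replicate_one, pow_one, Nat.factorial_one, Nat.cast_one, div_one] at h1
  rw [regTrunc, conv_cons, conv_nil, h, h1, harm_nil, oneExpC_nil, Finset.sum_sub_distrib, hsum]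
  push_cast
  ring

theorem differentiableAt_recip {z : ℂ} (hz : z ∈ strip) (n : ℕ) :
    DifferentiableAt ℂ (fun z => recip z (n + 1)) z := by
  unfold recip
  exact (differentiableAt_id.const_add _).inv (natCast_add_ne_zero hz n)

theorem differentiableOn_harm (N : ℕ) (w : List ℕ+) :
    DifferentiableOn ℂ (fun z => harm (recip z) N w) strip := by
  induction w using List.reverseRecOn generalizing N with
  | nil => simp only [harm_nil]; exact differentiableOn_const _
  | append_singleton w a ih =>
    simp only [harm_append_singleton]
    exact DifferentiableOn.fun_sum fun n _ => (ih n).mul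
      (DifferentiableOn.pow (fun z hz => (differentiableAt_recip hz n).differentiableWithinAt) _)

theorem differentiableOn_regTrunc (N : ℕ) (w : List ℕ+) :
    DifferentiableOn ℂ (fun z => regTrunc N z w) strip := by
  unfold regTrunc conv
  exact DifferentiableOn.fun_sum fun i _ => (differentiableOn_harm N _).mul_const _

theorem norm_recip_sub_le {z : ℂ} (hz : z ∈ strip) (n : ℕ) {s : ℝ} (hs0 : 0 ≤ s) (hs1 : s ≤ 1) :
    ‖recip z (n + 1) - (((n : ℝ) + 1)⁻¹ : ℝ)‖
      ≤ ‖z‖ * (4 * ((n : ℝ) + 1) ^ (-(2 - s)) * (max 1 |z.im|) ^ (-s)) := by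
  have hn : (0 : ℝ) < (n : ℝ) + 1 := by positivity
  have hn' : (n : ℂ) + 1 ≠ 0 := by exact_mod_cast hn.ne'
  have e : recip z (n + 1) - (((n : ℝ) + 1)⁻¹ : ℝ)
      = -(z * (recip z (n + 1) * (((n : ℝ) + 1)⁻¹ : ℝ))) := by
    have := natCast_add_ne_zero hz n
    push_cast at this
    rw [recip]
    push_cast
    field_simp
    ring
  have h2 : ((n : ℝ) + 1) ^ (-(2 - s)) = ((n : ℝ) + 1) ^ (-(1 - s)) * ((n : ℝ) + 1)⁻¹ := by
    rw [← Real.rpow_neg_one, ← Real.rpow_add hn]; ring_nf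
  rw [e, norm_neg, norm_mul, norm_mul, Complex.norm_real, Real.norm_of_nonneg (by positivity), h2]
  refine mul_le_mul_of_nonneg_left ?_ (norm_nonneg z)
  refine (mul_le_mul_of_nonneg_right (norm_recip_le_rpow hz n hs0 hs1) (by positivity)).trans_eq ?_
  ring

theorem eq_append_singleton_of_admissible {w : List ℕ+} (hw : Admissible w) (h0 : w ≠ []) :
    ∃ u a, a ≠ 1 ∧ w = u ++ [a] := by
  rcases w.eq_nil_or_concat with rfl | ⟨u, a, rfl⟩
  · exact absurd rfl h0
  · exact ⟨u, a, by simpa [Admissible] using hw, List.concat_eq_append⟩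

/-- This is the step of `stuffle_induction` in the form used for characters: the value at `w` is
recovered from the value at `(1)` and at simpler words. -/
theorem IsChar.step {R : Type*} [CommRing R] {f : List ℕ+ → R} (hf : IsChar f) {n : ℕ}
    {u w : List ℕ+} {M : Multiset (List ℕ+)} (h : stuffle u [1] = (n + 1) • {w} + M) :
    ((n + 1 : ℕ) : R) * f w = f u * f [1] - (M.map f).sum := by
  rw [hf.mul, h, Multiset.map_add, Multiset.sum_add, Multiset.map_nsmul, Multiset.sum_nsmul,
    Multiset.map_singleton, Multiset.sum_singleton, nsmul_eq_mul, add_sub_cancel_right]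

theorem tendstoLocallyUniformlyOn_multiset_sum {M : Multiset (List ℕ+)} {A : ℕ → ℂ → List ℕ+ → ℂ}
    {B : List ℕ+ → ℂ → ℂ} {s : Set ℂ}
    (h : ∀ w ∈ M, TendstoLocallyUniformlyOn (fun N z => A N z w) (B w) atTop s) :
    TendstoLocallyUniformlyOn (fun N z => (M.map (A N z)).sum)
      (fun z => (M.map fun w => B w z).sum) atTop s := by
  induction M using Multiset.induction with
  | empty =>
    simp only [Multiset.map_zero, Multiset.sum_zero]
    exact (tendsto_const_nhds.tendstoUniformlyOn_const s).tendstoLocallyUniformlyOn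
  | cons a M ih =>
    simp only [Multiset.map_cons, Multiset.sum_cons]
    exact (h a (Multiset.mem_cons_self a M)).fun_add
      (ih fun w hw => h w (Multiset.mem_cons_of_mem hw))

theorem exists_tendsto_regTrunc_one : ∃ F : ℂ → ℂ,
    TendstoLocallyUniformlyOn (fun N z => regTrunc N z [1]) F atTop strip := by
  refine ⟨fun z => ∑' n : ℕ, (recip z (n + 1) - (((n : ℝ) + 1)⁻¹ : ℝ)), ?_⟩
  simp only [regTrunc_one]
  refine tendstoLocallyUniformlyOn_of_forall_exists_nhds fun z₀ hz₀ =>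
    ⟨strip ∩ Metric.ball z₀ 1, Filter.inter_mem self_mem_nhdsWithin
      (mem_nhdsWithin_of_mem_nhds (Metric.ball_mem_nhds _ one_pos)), ?_⟩
  have hs : Summable fun n : ℕ => (‖z₀‖ + 1) * (4 * ((n : ℝ) + 1) ^ (-(2 - 0) : ℝ)) :=
    ((summable_succ_rpow (by norm_num)).mul_left 4).mul_left _
  refine tendstoUniformlyOn_tsum_nat hs fun n z hz => ?_
  have h := norm_recip_sub_le hz.1 n (s := 0) le_rfl zero_le_one
  rw [neg_zero, Real.rpow_zero, mul_one] at h
  refine h.trans (mul_le_mul_of_nonneg_right ?_ (by positivity))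
  have : ‖z - z₀‖ < 1 := by simpa [dist_eq_norm] using hz.2
  linarith [norm_le_norm_add_norm_sub' z z₀]

/-- Words with last letter `≥ 2` converge by the Weierstrass test, the word `(1)` because `1 / (n +
z) - 1 / n` is summable, and all others through `IsChar.step`. -/
theorem exists_tendsto_regTrunc (w : List ℕ+) : ∃ F : ℂ → ℂ,
    TendstoLocallyUniformlyOn (fun N z => regTrunc N z w) F atTop strip := by
  -- Products of locally uniform limits require continuous limit functions; holomorphy of the
  -- approximants provides this.
  have hcont : ∀ {w : List ℕ+} {F : ℂ → ℂ}, TendstoLocallyUniformlyOn (fun N z => regTrunc N z w) F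
      atTop strip → ContinuousOn F strip := fun {w} F h =>
    (h.differentiableOn (Eventually.of_forall fun N => differentiableOn_regTrunc N w)
      isOpen_strip).continuousOn
  induction w using stuffle_induction with
  | hadm k hk =>
    rcases eq_or_ne k [] with rfl | h0
    · refine ⟨fun _ => 1, ?_⟩
      simp only [(isChar_regTrunc _ _).nil]
      exact (tendsto_const_nhds.tendstoUniformlyOn_const _).tendstoLocallyUniformlyOn
    · obtain ⟨u, a, ha, rfl⟩ := eq_append_singleton_of_admissible hk h0
      obtain ⟨C, hC, h⟩ := exists_norm_harm_mul_le u a ha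
      simp only [regTrunc_append_singleton _ _ u ha]
      refine ⟨_, (tendstoUniformlyOn_tsum_nat (u := fun n : ℕ => C * ((n : ℝ) + 1) ^ (-(3 / 2) : ℝ))
        ((summable_succ_rpow (by norm_num)).mul_left C)
        fun n z hz => (h n z hz).trans ?_).tendstoLocallyUniformlyOn⟩
      refine mul_le_of_le_one_right (by positivity) ?_
      exact Real.rpow_le_one_of_one_le_of_nonpos (le_max_left _ _) (by norm_num)
  | hstep n u w M hu hM ih =>
    obtain ⟨F, hF⟩ := hu
    obtain ⟨F1, hF1⟩ := exists_tendsto_regTrunc_one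
    choose! B hB using ih
    have h1 := hF.mul₀ hF1 (hcont hF) (hcont hF1)
    have h2 := h1.sub (tendstoLocallyUniformlyOn_multiset_sum hB)
    have hc := (tendsto_const_nhds (x := (((n + 1 : ℕ) : ℂ)⁻¹)) (f := atTop (α := ℕ))
      |>.tendstoUniformlyOn_const strip).tendstoLocallyUniformlyOn
    have h3 := hc.mul₀ h2 continuousOn_const ?_
    · refine ⟨_, h3.congr fun N z hz => ?_⟩
      have := (isChar_regTrunc N z).step hM
      have hn : ((n + 1 : ℕ) : ℂ) ≠ 0 := by exact_mod_cast n.succ_ne_zero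
      simp only [Pi.mul_apply, Pi.sub_apply, ← this]
      exact inv_mul_cancel_left₀ hn _
    · refine ((hcont hF).mul (hcont hF1)).sub ?_
      exact (TendstoLocallyUniformlyOn.differentiableOn (tendstoLocallyUniformlyOn_multiset_sum hB)
        (Eventually.of_forall fun N => by
          have hd : ∀ M : Multiset (List ℕ+),
              DifferentiableOn ℂ (fun z => (M.map (regTrunc N z)).sum) strip := by
            intro M
            induction M using Multiset.induction with
            | empty => simp
            | cons a M ih =>
              simp only [Multiset.map_cons, Multiset.sum_cons]
              exact (differentiableOn_regTrunc N a).add ih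
          exact hd M) isOpen_strip).continuousOn

/-- The regularized multiple Hurwitz zeta function
`∑_{0 < m_1 < ⋯ < m_d} 1 / ((m_1 + z) ^ k_1 ⋯ (m_d + z) ^ k_d)` on the strip. -/
noncomputable def hurwitz (w : List ℕ+) : ℂ → ℂ := Classical.choose (exists_tendsto_regTrunc w)

theorem tendsto_hurwitz (w : List ℕ+) :
    TendstoLocallyUniformlyOn (fun N z => regTrunc N z w) (hurwitz w) atTop strip :=
  Classical.choose_spec (exists_tendsto_regTrunc w)

theorem tendsto_hurwitz_at (w : List ℕ+) {z : ℂ} (hz : z ∈ strip) :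
    Tendsto (fun N => regTrunc N z w) atTop (𝓝 (hurwitz w z)) :=
  (tendsto_hurwitz w).tendsto_at hz

theorem differentiableOn_hurwitz (w : List ℕ+) : DifferentiableOn ℂ (hurwitz w) strip :=
  (tendsto_hurwitz w).differentiableOn
    (Eventually.of_forall fun N => differentiableOn_regTrunc N w) isOpen_strip

theorem isChar_hurwitz {z : ℂ} (hz : z ∈ strip) : IsChar fun w => hurwitz w z := by
  refine ⟨?_, fun u v => ?_⟩
  · refine tendsto_nhds_unique (tendsto_hurwitz_at [] hz) ?_
    simp only [(isChar_regTrunc _ _).nil]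
    exact tendsto_const_nhds
  · refine tendsto_nhds_unique ((tendsto_hurwitz_at u hz).mul (tendsto_hurwitz_at v hz)) ?_
    simp only [(isChar_regTrunc _ _).mul]
    exact tendsto_multiset_sum _ fun w _ => tendsto_hurwitz_at w hz

theorem tendsto_conv {f g : ℕ → List ℕ+ → ℂ} {F G : List ℕ+ → ℂ}
    (hf : ∀ w, Tendsto (fun N => f N w) atTop (𝓝 (F w)))
    (hg : ∀ w, Tendsto (fun N => g N w) atTop (𝓝 (G w))) (w : List ℕ+) :
    Tendsto (fun N => conv (f N) (g N) w) atTop (𝓝 (conv F G w)) := by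
  unfold conv
  exact tendsto_finsetSum _ fun i _ => (hf _).mul (hg _)

theorem tendsto_oneExpC_zero {c : ℕ → ℂ} (hc : Tendsto c atTop (𝓝 0)) (w : List ℕ+) :
    Tendsto (fun N => oneExpC (c N) w) atTop (𝓝 (unitWord w)) := by
  rcases w with _ | ⟨a, w⟩
  · simp [oneExpC_nil, unitWord]
  · have h := (hc.pow (weight (a :: w))).mul_const (oneExp 1 (a :: w) : ℂ)
    have ha := a.pos
    rw [zero_pow (by rw [weight_cons]; omega), zero_mul] at h
    simpa [unitWord, oneExpC] using h

/-- The shift adds the summand `1 / z` in front. At finite level the harmonic numbers differ by `1 /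
(N + 1)`, which leaves an exponential factor on the right that tends to the unit. -/
theorem hurwitz_sub_one {z : ℂ} (hz : z ∈ strip) (hz1 : z - 1 ∈ strip) (w : List ℕ+) :
    hurwitz w (z - 1) = conv (letter z⁻¹) (fun u => hurwitz u z) w := by
  have e : ∀ N, regTrunc (N + 1) (z - 1)
      = conv (conv (letter z⁻¹) (regTrunc N z)) (oneExpC (-((((N : ℝ) + 1)⁻¹ : ℝ) : ℂ))) := by
    intro N
    have h1 : harm (recip (z - 1)) (N + 1) = conv (letter z⁻¹) (harm (recip z) N) := by
      rw [harm_shift _ (recip z) (fun n _ => by simp only [recip]; push_cast; ring_nf) N]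
      simp [recip]
    have h2 : regTrunc N z = conv (harm (recip z) N) (oneExpC (-(hsum N : ℝ))) := rfl
    have h3 : regTrunc (N + 1) (z - 1)
        = conv (harm (recip (z - 1)) (N + 1)) (oneExpC (-(hsum (N + 1) : ℝ))) := rfl
    rw [h3, h2, h1, conv_assoc, conv_assoc, conv_assoc, conv_oneExpC, hsum_succ]
    push_cast
    ring_nf
  refine tendsto_nhds_unique ((tendsto_add_atTop_iff_nat 1).2 (tendsto_hurwitz_at w hz1)) ?_
  simp only [e]
  have h0 : Tendsto (fun N : ℕ => -((((N : ℝ) + 1)⁻¹ : ℝ) : ℂ)) atTop (𝓝 0) := by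
    have h : Tendsto (fun N : ℕ => ((N : ℝ) + 1)⁻¹) atTop (𝓝 0) := by
      simpa [one_div] using tendsto_one_div_add_atTop_nhds_zero_nat (𝕜 := ℝ)
    have := ((Complex.continuous_ofReal.tendsto 0).comp h).neg
    simpa using this
  have := tendsto_conv (tendsto_conv (f := fun _ => letter z⁻¹) (fun w => tendsto_const_nhds)
    (fun w => tendsto_hurwitz_at w hz)) (tendsto_oneExpC_zero h0) w
  rwa [conv_unit_right] at this

/-! Values at zero -/

/-- The recursion of `trunc` peels off the factors `letter (1 / m)` one at a time, from the largest
`m` inwards; after `r` steps the first `N - r` factors remain. -/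
theorem regTrunc_zero (N : ℕ) (w : List ℕ+) :
    regTrunc N 0 w = ((trunc (oneExp (-hsum N)) N N w : ℝ) : ℂ) := by
  have h : ∀ r ≤ N, conv (harm (recip 0) (N - r))
      (fun w => ((trunc (oneExp (-hsum N)) N r w : ℝ) : ℂ)) = regTrunc N 0 := by
    intro r
    induction r with
    | zero =>
      intro _
      have e : (fun w => ((trunc (oneExp (-hsum N)) N 0 w : ℝ) : ℂ)) = oneExpC (-(hsum N : ℝ)) := by
        funext w
        rw [trunc, ofReal_oneExp]
        push_cast
        rfl
      rw [e, Nat.sub_zero]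
      rfl
    | succ r ih =>
      intro hr
      rw [← ih (by omega), show N - r = N - (r + 1) + 1 by omega, harm, conv_assoc]
      congr 1
      funext w
      rcases w with _ | ⟨a, w⟩
      · rw [conv_letter_nil, trunc]
      · rw [conv_letter_cons, trunc, show N - (r + 1) + 1 = N - r by omega]
        simp [recip]
  have := congrFun (h N le_rfl) w
  rwa [Nat.sub_self, harm, conv_unit_left, eq_comm] at this

/-- The values at `0` are real limits satisfying the axioms of a stuffle regularization, so
uniqueness identifies them. -/
theorem hurwitz_zero (w : List ℕ+) : hurwitz w 0 = (zetaReg w : ℂ) := by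
  have hre : ∀ w, Tendsto (fun N => trunc (oneExp (-hsum N)) N N w) atTop
      (𝓝 (hurwitz w 0).re) := by
    intro w
    have h := (Complex.continuous_re.tendsto _).comp (tendsto_hurwitz_at w zero_mem_strip)
    refine h.congr fun N => ?_
    rw [Function.comp_apply, regTrunc_zero, Complex.ofReal_re]
  have hreg : IsStuffleRegularization fun w => (hurwitz w 0).re := by
    refine ⟨fun k hk => tendsto_nhds_unique (hre k) (tendsto_trunc hk _), ?_, fun u v => ?_⟩
    · refine tendsto_nhds_unique (hre [1]) ?_
      have : ∀ N, trunc (oneExp (-hsum N)) N N [1] = 0 := by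
        intro N
        have h := regTrunc_zero N [1]
        rw [regTrunc_one, Finset.sum_eq_zero] at h
        · exact_mod_cast h.symm
        · intro n _
          simp [recip]
      simp only [this]
      exact tendsto_const_nhds
    · refine tendsto_nhds_unique ((hre u).mul (hre v)) ?_
      simp only [(trunc_mul (by simp [oneExp]) (oneExp_mul _) _ _).2]
      exact tendsto_multiset_sum _ fun w _ => hre w
  rw [← hreg.unique isStuffleRegularization_zetaReg]
  refine tendsto_nhds_unique (tendsto_hurwitz_at w zero_mem_strip) ?_
  refine ((Complex.continuous_ofReal.tendsto _).comp (hre w)).congr fun N => ?_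
  rw [Function.comp_apply, regTrunc_zero]

/-- The antipode relation holds for every truncation and involves finitely many words, so it passes
to the limit. -/
theorem conv_star_zetaReg :
    conv (fun u => ((-1) ^ u.length * zetaStarReg u : ℂ)) (fun u => (zetaReg u.reverse : ℂ))
      = unitWord := by
  funext w
  have h1 : ∀ u, Tendsto (fun N => star (regTrunc N 0) u) atTop
      (𝓝 ((-1) ^ u.length * zetaStarReg u : ℂ)) := by
    intro u
    have e : ((zetaStarReg u : ℝ) : ℂ) = ((merges u).map fun w => hurwitz w 0).sum := by
      rw [zetaStarReg, ← Complex.ofRealHom_eq_coe, map_list_sum, List.map_map]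
      exact congrArg List.sum (List.map_congr_left fun w _ => (hurwitz_zero w).symm)
    rw [e]
    exact (tendsto_list_sum _ fun w _ => tendsto_hurwitz_at w zero_mem_strip).const_mul _
  have h2 : ∀ u : List ℕ+, Tendsto (fun N => regTrunc N 0 u.reverse) atTop
      (𝓝 (zetaReg u.reverse : ℂ)) := fun u => by
    rw [← hurwitz_zero]
    exact tendsto_hurwitz_at _ zero_mem_strip
  refine tendsto_nhds_unique (tendsto_conv h1 h2 w) ?_
  simp only [star_antipode_regTrunc]
  exact tendsto_const_nhds

/-! Taylor coefficients -/

section Coefficients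

variable {R : Type*} [CommRing R]

/-- The derivation `(k_1, …, k_d) ↦ -∑_j k_j (k_1, …, k_j + 1, …, k_d)`, applied in the argument
of a function. -/
def wordDeriv (f : List ℕ+ → R) : List ℕ+ → R
  | [] => 0
  | k :: u => -(k : ℕ) * f ((k + 1) :: u) + wordDeriv (fun v => f (k :: v)) u

/-- The coefficient of `x ^ i` in `(1 + x) ^ (-k)`. -/
def binomCoeff (k : ℕ+) (i : ℕ) : R := (-1) ^ i * (((k : ℕ) - 1 + i).choose i : R)

/-- The letter `k + i`. -/
def addNat (k : ℕ+) (i : ℕ) : ℕ+ := ⟨(k : ℕ) + i, Nat.add_pos_left k.pos _⟩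

/-- The coefficients of the Taylor expansion, as functions of the values at words. -/
def wordCoeff (f : List ℕ+ → R) : List ℕ+ → ℕ → R
  | [], a => if a = 0 then f [] else 0
  | k :: u, a => ∑ p ∈ Finset.HasAntidiagonal.antidiagonal a,
      binomCoeff k p.1 * wordCoeff (fun v => f (addNat k p.1 :: v)) u p.2

theorem binomCoeff_succ (k : ℕ+) (i : ℕ) :
    ((i + 1 : ℕ) : R) * binomCoeff k (i + 1) = -((k : ℕ) + i : ℕ) * binomCoeff k i := by
  have h := Nat.add_one_mul_choose_eq ((k : ℕ) - 1 + i) i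
  have hk := k.pos
  rw [show (k : ℕ) - 1 + i + 1 = k + i by omega] at h
  have h' : (((k : ℕ) + i : ℕ) : R) * (((k : ℕ) - 1 + i).choose i : R)
      = (((k : ℕ) + i).choose (i + 1) : R) * ((i + 1 : ℕ) : R) := by
    rw [← Nat.cast_mul, ← Nat.cast_mul, h]
  rw [binomCoeff, binomCoeff, show (k : ℕ) - 1 + (i + 1) = k + i by omega, pow_succ]
  linear_combination (-1) ^ i * h'

theorem wordCoeff_zero (f : List ℕ+ → R) (w : List ℕ+) : wordCoeff f w 0 = f w := by
  induction w generalizing f with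
  | nil => simp [wordCoeff]
  | cons k u ih =>
    have h : addNat k 0 = k := rfl
    simp [wordCoeff, binomCoeff, ih, h]

theorem wordCoeff_add (f g : List ℕ+ → R) (w : List ℕ+) (a : ℕ) :
    wordCoeff (fun v => f v + g v) w a = wordCoeff f w a + wordCoeff g w a := by
  induction w generalizing f g a with
  | nil => simp only [wordCoeff]; split_ifs <;> simp
  | cons k u ih => simp only [wordCoeff, ih, mul_add, Finset.sum_add_distrib]

theorem wordCoeff_mul (c : R) (f : List ℕ+ → R) (w : List ℕ+) (a : ℕ) :
    wordCoeff (fun v => c * f v) w a = c * wordCoeff f w a := by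
  induction w generalizing f a with
  | nil => simp only [wordCoeff]; split_ifs <;> simp
  | cons k u ih =>
    simp only [wordCoeff, ih, Finset.mul_sum]
    exact Finset.sum_congr rfl fun p _ => by ring

/-- This is Taylor's recursion for `∏ (m_j + z)^{-k_j}`. The factor `a + 1` is split as the sum of
the degree in the first letter and the degree in the others, as in the Leibniz rule. -/
theorem wordCoeff_succ (f : List ℕ+ → R) (w : List ℕ+) (a : ℕ) :
    ((a + 1 : ℕ) : R) * wordCoeff f w (a + 1) = wordCoeff (wordDeriv f) w a := by
  induction w generalizing f a with
  | nil => simp [wordCoeff, wordDeriv]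
  | cons k u ih =>
    have e : ∀ i, addNat k i + 1 = addNat k (i + 1) := fun i => PNat.eq (Nat.add_assoc _ _ _)
    have e1 : ((a + 1 : ℕ) : R) * wordCoeff f (k :: u) (a + 1)
        = ∑ p ∈ Finset.HasAntidiagonal.antidiagonal (a + 1), ((p.1 : R) * (binomCoeff k p.1 *
            wordCoeff (fun v => f (addNat k p.1 :: v)) u p.2) + (p.2 : R) * (binomCoeff k p.1 *
            wordCoeff (fun v => f (addNat k p.1 :: v)) u p.2)) := by
      rw [wordCoeff, Finset.mul_sum]
      refine Finset.sum_congr rfl fun p hp => ?_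
      rw [← Finset.HasAntidiagonal.mem_antidiagonal.1 hp]
      push_cast
      ring
    rw [e1, Finset.sum_add_distrib, Finset.Nat.sum_antidiagonal_succ,
      Finset.Nat.sum_antidiagonal_succ']
    simp only [Nat.cast_zero, zero_mul, zero_add]
    rw [wordCoeff, ← Finset.sum_add_distrib]
    refine Finset.sum_congr rfl fun p _ => ?_
    have h1 := ih (fun v => f (addNat k p.1 :: v)) p.2
    have h2 := binomCoeff_succ (R := R) k p.1
    simp only [wordDeriv]
    rw [wordCoeff_add, wordCoeff_mul, ← h1, e]
    have h3 : ((addNat k p.1 : ℕ+) : ℕ) = k + p.1 := rfl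
    rw [h3]
    linear_combination (wordCoeff (fun v => f (addNat k (p.1 + 1) :: v)) u p.2) * h2

theorem wordDeriv_add (f g : List ℕ+ → R) (w : List ℕ+) :
    wordDeriv (fun v => f v + g v) w = wordDeriv f w + wordDeriv g w := by
  induction w generalizing f g with
  | nil => simp [wordDeriv]
  | cons k u ih => simp only [wordDeriv, ih]; ring

theorem wordDeriv_mul (c : R) (f : List ℕ+ → R) (w : List ℕ+) :
    wordDeriv (fun v => c * f v) w = c * wordDeriv f w := by
  induction w generalizing f with
  | nil => simp [wordDeriv]
  | cons k u ih => simp only [wordDeriv, ih]; ring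

theorem wordDeriv_conv_letter (x : R) (f : List ℕ+ → R) (k : ℕ+) (u : List ℕ+) :
    wordDeriv (conv (letter x) f) (k :: u) = wordDeriv f (k :: u)
      + (x ^ (k : ℕ) * wordDeriv f u - (k : ℕ) * x ^ ((k : ℕ) + 1) * f u) := by
  simp only [wordDeriv, conv_letter_cons]
  rw [wordDeriv_add, wordDeriv_mul, PNat.add_coe, PNat.one_coe]
  ring

end Coefficients

/-- Raising a letter makes it `≥ 2`, where the exponential vanishes; this matches the regularizing
factor being independent of `z`. -/
theorem wordDeriv_oneExpC (c : ℂ) (v w : List ℕ+) :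
    wordDeriv (fun u => oneExpC c (v ++ u)) w = 0 := by
  induction w generalizing v with
  | nil => rfl
  | cons k u ih =>
    have h := ih (v ++ [k])
    simp only [List.append_assoc, List.singleton_append] at h
    rw [wordDeriv, h, oneExpC_of_mem (x := k + 1) (List.mem_append_right _ List.mem_cons_self)
      (pnat_add_ne_one k 1), mul_zero, add_zero]

theorem hasDerivAt_conv_harm (N : ℕ) {z : ℂ} (hz : z ∈ strip) (f : ℂ → List ℕ+ → ℂ)
    (hf : ∀ w, HasDerivAt (fun z => f z w) (wordDeriv (f z) w) z) (w : List ℕ+) :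
    HasDerivAt (fun z => conv (harm (recip z) N) (f z) w)
      (wordDeriv (conv (harm (recip z) N) (f z)) w) z := by
  induction N generalizing f with
  | zero => simp only [harm, conv_unit_left]; exact hf w
  | succ N ih =>
    simp only [harm, conv_assoc]
    refine ih (fun z => conv (letter (recip z (N + 1))) (f z)) fun w => ?_
    rcases w with _ | ⟨k, u⟩
    · simp only [conv_letter_nil]
      exact hf []
    · simp only [conv_letter_cons]
      rw [wordDeriv_conv_letter]
      refine (hf _).fun_add ?_
      have h1 : HasDerivAt (fun z => recip z (N + 1)) (-(recip z (N + 1)) ^ 2) z := by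
        have := ((hasDerivAt_id z).const_add (((N + 1 : ℕ) : ℂ))).inv (natCast_add_ne_zero hz N)
        convert! this using 1
        simp [recip, div_eq_mul_inv]
      convert! (h1.fun_pow (k : ℕ)).fun_mul (hf u) using 1
      have h2 : recip z (N + 1) ^ ((k : ℕ) + 1)
          = recip z (N + 1) ^ ((k : ℕ) - 1) * recip z (N + 1) ^ 2 := by
        rw [← pow_add]
        congr 1
        have := k.pos
        omega
      rw [h2]
      ring

theorem hasDerivAt_regTrunc (N : ℕ) {z : ℂ} (hz : z ∈ strip) (w : List ℕ+) :
    HasDerivAt (fun z => regTrunc N z w) (wordDeriv (regTrunc N z) w) z := by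
  refine hasDerivAt_conv_harm N hz (fun _ => oneExpC (-(hsum N : ℝ))) (fun w => ?_) w
  have := wordDeriv_oneExpC (-(hsum N : ℝ)) [] w
  simp only [List.nil_append] at this
  rw [show wordDeriv (oneExpC (-(hsum N : ℝ))) w = 0 from this]
  exact hasDerivAt_const _ _

theorem tendsto_wordDeriv {f : ℕ → List ℕ+ → ℂ} {F : List ℕ+ → ℂ}
    (hf : ∀ w, Tendsto (fun N => f N w) atTop (𝓝 (F w))) (w : List ℕ+) :
    Tendsto (fun N => wordDeriv (f N) w) atTop (𝓝 (wordDeriv F w)) := by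
  induction w generalizing f F with
  | nil => exact tendsto_const_nhds
  | cons k u ih => exact ((hf _).const_mul _).add (ih fun v => hf (k :: v))

/-- Locally uniform limits of holomorphic functions may be differentiated termwise, and the
derivative of each truncation is a finite combination of truncations. -/
theorem hasDerivAt_hurwitz {z : ℂ} (hz : z ∈ strip) (w : List ℕ+) :
    HasDerivAt (hurwitz w) (wordDeriv (fun w => hurwitz w z) w) z := by
  have h1 := ((tendsto_hurwitz w).deriv
    (Eventually.of_forall fun N => differentiableOn_regTrunc N w) isOpen_strip).tendsto_at hz
  have h2 := tendsto_wordDeriv (fun w => tendsto_hurwitz_at w hz) w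
  rw [← tendsto_nhds_unique h1 (h2.congr fun N => (hasDerivAt_regTrunc N hz w).deriv.symm)]
  exact ((differentiableOn_hurwitz w).differentiableAt (isOpen_strip.mem_nhds hz)).hasDerivAt

theorem iterate_wordDeriv (f : List ℕ+ → ℂ) (w : List ℕ+) (a : ℕ) :
    wordDeriv^[a] f w = (a.factorial : ℂ) * wordCoeff f w a := by
  induction a generalizing f with
  | zero => simp [wordCoeff_zero]
  | succ a ih =>
    rw [Function.iterate_succ_apply, ih, ← wordCoeff_succ, Nat.factorial_succ]
    push_cast
    ring

theorem hasDerivAt_wordDeriv {F : ℂ → List ℕ+ → ℂ} {D : List ℕ+ → ℂ} {z : ℂ}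
    (h : ∀ w, HasDerivAt (fun z => F z w) (D w) z) (w : List ℕ+) :
    HasDerivAt (fun z => wordDeriv (F z) w) (wordDeriv D w) z := by
  induction w generalizing F D with
  | nil => exact hasDerivAt_const _ _
  | cons k u ih => exact ((h _).const_mul _).fun_add (ih fun v => h (k :: v))

theorem hasDerivAt_iterate_wordDeriv {z : ℂ} (hz : z ∈ strip) (a : ℕ) (w : List ℕ+) :
    HasDerivAt (fun z => wordDeriv^[a] (fun w => hurwitz w z) w)
      (wordDeriv^[a + 1] (fun w => hurwitz w z) w) z := by
  induction a generalizing w with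
  | zero => exact hasDerivAt_hurwitz hz w
  | succ a ih =>
    simp only [Function.iterate_succ_apply'] at ih ⊢
    exact hasDerivAt_wordDeriv ih w

theorem iteratedDeriv_hurwitz (a : ℕ) (w : List ℕ+) {z : ℂ} (hz : z ∈ strip) :
    iteratedDeriv a (hurwitz w) z = (a.factorial : ℂ) * wordCoeff (fun w => hurwitz w z) w a := by
  rw [← iterate_wordDeriv]
  induction a generalizing z with
  | zero => simp
  | succ a ih =>
    rw [iteratedDeriv_succ]
    refine HasDerivAt.deriv ?_
    refine (hasDerivAt_iterate_wordDeriv hz a w).congr_of_eventuallyEq ?_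
    filter_upwards [isOpen_strip.mem_nhds hz] with y hy using ih hy

theorem wordCoeff_eq_sum (f : List ℕ+ → ℝ) (w : List ℕ+) (a : ℕ) :
    wordCoeff f w a = (-1) ^ a * ∑ e ∈ Finset.Nat.antidiagonalTuple w.length a,
      f (shift w e) * ∏ j, (((w.get j : ℕ) - 1 + e j).choose (e j) : ℝ) := by
  induction w generalizing f a with
  | nil =>
    rcases a with _ | a
    · have h : shift [] (![] : Fin 0 → ℕ) = [] := rfl
      simp [wordCoeff, h]
    · simp [wordCoeff]
  | cons k u ih =>
    rw [wordCoeff]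
    have e : ∑ e ∈ Finset.Nat.antidiagonalTuple (k :: u).length a,
        f (shift (k :: u) e) * ∏ j, ((((k :: u).get j : ℕ) - 1 + e j).choose (e j) : ℝ)
        = ∑ p ∈ Finset.HasAntidiagonal.antidiagonal a, ∑ e ∈ Finset.Nat.antidiagonalTuple u.length p.2,
          f (addNat k p.1 :: shift u e) * ((((k : ℕ) - 1 + p.1).choose p.1 : ℝ) *
            ∏ j, (((u.get j : ℕ) - 1 + e j).choose (e j) : ℝ)) := by
      rw [Finset.sum_sigma']
      refine Finset.sum_bij' (fun (e : Fin (u.length + 1) → ℕ) _ =>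
          (⟨(e 0, ∑ i, Fin.tail e i), Fin.tail e⟩ : (_ : ℕ × ℕ) × (Fin u.length → ℕ)))
        (fun p _ => (Fin.cons p.1.1 p.2 : Fin (u.length + 1) → ℕ)) ?_ ?_ ?_ ?_ ?_
      · intro e he
        have he : ∑ i : Fin (u.length + 1), e i = a := Finset.Nat.mem_antidiagonalTuple.1 he
        rw [Fin.sum_univ_succ] at he
        simp only [Finset.mem_sigma, Finset.HasAntidiagonal.mem_antidiagonal, Finset.Nat.mem_antidiagonalTuple]
        exact ⟨he, trivial⟩
      · rintro ⟨⟨i, j⟩, e⟩ he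
        simp only [Finset.mem_sigma, Finset.HasAntidiagonal.mem_antidiagonal, Finset.Nat.mem_antidiagonalTuple] at he
        refine Finset.Nat.mem_antidiagonalTuple.2 ?_
        refine (Fin.sum_univ_succ (n := u.length) _).trans ?_
        simpa [he.2] using he.1
      · intro e _
        exact Fin.cons_self_tail e
      · rintro ⟨⟨i, j⟩, e⟩ he
        simp only [Finset.mem_sigma, Finset.HasAntidiagonal.mem_antidiagonal, Finset.Nat.mem_antidiagonalTuple] at he
        simp [he.2]
      · intro e _
        refine congrArg₂ (· * ·) ?_ (Fin.prod_univ_succ (n := u.length) _)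
        refine congrArg f ?_
        exact List.ofFn_succ (n := u.length)
    rw [e, Finset.mul_sum]
    refine Finset.sum_congr rfl fun p hp => ?_
    rw [ih, ← Finset.HasAntidiagonal.mem_antidiagonal.1 hp, pow_add, binomCoeff]
    simp only [Finset.mul_sum]
    exact Finset.sum_congr rfl fun e _ => by ring

theorem ofReal_wordCoeff (f : List ℕ+ → ℝ) (w : List ℕ+) (a : ℕ) :
    ((wordCoeff f w a : ℝ) : ℂ) = wordCoeff (fun w => (f w : ℂ)) w a := by
  induction w generalizing f a with
  | nil => simp only [wordCoeff]; split_ifs <;> simp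
  | cons k u ih => simp [wordCoeff, binomCoeff, ih]

theorem wordCoeff_hurwitz_zero (w : List ℕ+) (a : ℕ) :
    wordCoeff (fun w => hurwitz w 0) w a = (zetaRegCoeff a w : ℂ) := by
  simp only [hurwitz_zero]
  rw [← ofReal_wordCoeff, wordCoeff_eq_sum, zetaRegCoeff]

theorem hasSum_hurwitz (w : List ℕ+) {z : ℂ} (hz : z ∈ Metric.ball (0 : ℂ) (3 / 4)) :
    HasSum (fun a : ℕ => (zetaRegCoeff a w : ℂ) * z ^ a) (hurwitz w z) := by
  have hsub : Metric.ball (0 : ℂ) (3 / 4) ⊆ strip := fun y hy =>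
    lt_of_le_of_lt (Complex.abs_re_le_norm y) (by simpa using hy)
  have h := Complex.hasSum_taylorSeries_on_ball ((differentiableOn_hurwitz w).mono hsub) hz
  convert! h using 2 with a
  rw [iteratedDeriv_hurwitz a w zero_mem_strip, wordCoeff_hurwitz_zero, sub_zero, smul_eq_mul,
    smul_eq_mul]
  have := Nat.cast_ne_zero (R := ℂ).2 (Nat.factorial_ne_zero a)
  field_simp

/-! ### Growth and decay in the imaginary direction -/

/-- Power decay in `Im z` on the strip. -/
def IsDecaying (f : ℂ → ℂ) : Prop :=
  ∃ s : ℝ, 0 < s ∧ ∃ C, 0 ≤ C ∧ ∀ z ∈ strip, 1 ≤ |z.im| → ‖f z‖ ≤ C * |z.im| ^ (-s)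

/-- Growth slower than every power of `Im z` on the strip. -/
def IsSlow (f : ℂ → ℂ) : Prop :=
  ∀ s : ℝ, 0 < s → ∃ C, 0 ≤ C ∧ ∀ z ∈ strip, 1 ≤ |z.im| → ‖f z‖ ≤ C * |z.im| ^ s

theorem IsDecaying.congr {f g : ℂ → ℂ} (hf : IsDecaying f)
    (h : ∀ z ∈ strip, 1 ≤ |z.im| → f z = g z) : IsDecaying g := by
  obtain ⟨s, hs, C, hC, hf⟩ := hf
  exact ⟨s, hs, C, hC, fun z hz hy => by rw [← h z hz hy]; exact hf z hz hy⟩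

theorem IsDecaying.isSlow {f : ℂ → ℂ} (hf : IsDecaying f) : IsSlow f := by
  obtain ⟨s, hs, C, hC, hf⟩ := hf
  refine fun t ht => ⟨C, hC, fun z hz hy => (hf z hz hy).trans ?_⟩
  exact mul_le_mul_of_nonneg_left (Real.rpow_le_rpow_of_exponent_le hy (by linarith)) hC

theorem isDecaying_zero : IsDecaying fun _ => 0 :=
  ⟨1, one_pos, 0, le_rfl, fun z _ _ => by simp⟩

theorem isSlow_const (c : ℂ) : IsSlow fun _ => c :=
  fun _ hs => ⟨‖c‖, norm_nonneg c, fun _ _ hy =>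
    le_mul_of_one_le_right (norm_nonneg c) (Real.one_le_rpow hy hs.le)⟩

theorem IsDecaying.add {f g : ℂ → ℂ} (hf : IsDecaying f) (hg : IsDecaying g) :
    IsDecaying fun z => f z + g z := by
  obtain ⟨s, hs, C, hC, hf⟩ := hf
  obtain ⟨t, ht, D, hD, hg⟩ := hg
  refine ⟨min s t, lt_min hs ht, C + D, by positivity, fun z hz hy => ?_⟩
  rw [add_mul]
  refine norm_add_le_of_le ((hf z hz hy).trans ?_) ((hg z hz hy).trans ?_)
  · exact mul_le_mul_of_nonneg_left
      (Real.rpow_le_rpow_of_exponent_le hy (neg_le_neg (min_le_left s t))) hC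
  · exact mul_le_mul_of_nonneg_left
      (Real.rpow_le_rpow_of_exponent_le hy (neg_le_neg (min_le_right s t))) hD

theorem IsSlow.add {f g : ℂ → ℂ} (hf : IsSlow f) (hg : IsSlow g) :
    IsSlow fun z => f z + g z := by
  intro s hs
  obtain ⟨C, hC, hf⟩ := hf s hs
  obtain ⟨D, hD, hg⟩ := hg s hs
  refine ⟨C + D, by positivity, fun z hz hy => ?_⟩
  rw [add_mul]
  exact norm_add_le_of_le (hf z hz hy) (hg z hz hy)

theorem IsSlow.mul {f g : ℂ → ℂ} (hf : IsSlow f) (hg : IsSlow g) :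
    IsSlow fun z => f z * g z := by
  intro s hs
  obtain ⟨C, hC, hf⟩ := hf (s / 2) (by positivity)
  obtain ⟨D, hD, hg⟩ := hg (s / 2) (by positivity)
  refine ⟨C * D, by positivity, fun z hz hy => ?_⟩
  have h0 : 0 < |z.im| := by linarith
  rw [norm_mul]
  refine (mul_le_mul (hf z hz hy) (hg z hz hy) (norm_nonneg _) (by positivity)).trans_eq ?_
  rw [show |z.im| ^ s = |z.im| ^ (s / 2) * |z.im| ^ (s / 2) by
    rw [← Real.rpow_add h0, add_halves]]
  ring

theorem IsDecaying.mul {f g : ℂ → ℂ} (hf : IsDecaying f) (hg : IsSlow g) :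
    IsDecaying fun z => f z * g z := by
  obtain ⟨s, hs, C, hC, hf⟩ := hf
  obtain ⟨D, hD, hg⟩ := hg (s / 2) (by positivity)
  refine ⟨s / 2, by positivity, C * D, by positivity, fun z hz hy => ?_⟩
  have h0 : 0 < |z.im| := by linarith
  rw [norm_mul]
  refine (mul_le_mul (hf z hz hy) (hg z hz hy) (norm_nonneg _) (by positivity)).trans_eq ?_
  rw [show |z.im| ^ (-(s / 2)) = |z.im| ^ (-s) * |z.im| ^ (s / 2) by
    rw [← Real.rpow_add h0]; congr 1; ring]
  ring

theorem IsSlow.mul_decaying {f g : ℂ → ℂ} (hf : IsSlow f) (hg : IsDecaying g) :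
    IsDecaying fun z => f z * g z :=
  (hg.mul hf).congr fun _ _ _ => mul_comm _ _

theorem IsSlow.pow {f : ℂ → ℂ} (hf : IsSlow f) (n : ℕ) : IsSlow fun z => f z ^ n := by
  induction n with
  | zero => simpa using isSlow_const 1
  | succ n ih => simp only [pow_succ]; exact ih.mul hf

theorem IsDecaying.sub {f g : ℂ → ℂ} (hf : IsDecaying f) (hg : IsDecaying g) :
    IsDecaying fun z => f z - g z :=
  (hf.add ((isSlow_const (-1)).mul_decaying hg)).congr fun _ _ _ => by ring

theorem IsDecaying.comp_neg {f : ℂ → ℂ} (hf : IsDecaying f) : IsDecaying fun z => f (-z) := by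
  obtain ⟨s, hs, C, hC, hf⟩ := hf
  refine ⟨s, hs, C, hC, fun z hz hy => ?_⟩
  simpa using hf (-z) (neg_mem_strip hz) (by simpa using hy)

theorem IsSlow.comp_neg {f : ℂ → ℂ} (hf : IsSlow f) : IsSlow fun z => f (-z) := by
  intro s hs
  obtain ⟨C, hC, hf⟩ := hf s hs
  refine ⟨C, hC, fun z hz hy => ?_⟩
  simpa using hf (-z) (neg_mem_strip hz) (by simpa using hy)

theorem isDecaying_sum {ι : Type*} {s : Finset ι} {f : ι → ℂ → ℂ}
    (h : ∀ i ∈ s, IsDecaying (f i)) : IsDecaying fun z => ∑ i ∈ s, f i z := by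
  classical
  induction s using Finset.induction with
  | empty => simpa using isDecaying_zero
  | insert a s ha ih =>
    simp only [Finset.sum_insert ha]
    exact (h a (Finset.mem_insert_self a s)).add
      (ih fun i hi => h i (Finset.mem_insert_of_mem hi))

theorem isDecaying_multiset_sum {M : Multiset (List ℕ+)} {f : List ℕ+ → ℂ → ℂ}
    (h : ∀ w ∈ M, IsDecaying (f w)) : IsDecaying fun z => (M.map fun w => f w z).sum := by
  induction M using Multiset.induction with
  | empty => simpa using isDecaying_zero
  | cons a M ih =>
    simp only [Multiset.map_cons, Multiset.sum_cons]
    exact (h a (Multiset.mem_cons_self a M)).add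
      (ih fun w hw => h w (Multiset.mem_cons_of_mem hw))

theorem IsSlow.oneExpC {f : ℂ → ℂ} (hf : IsSlow f) (w : List ℕ+) :
    IsSlow fun z => oneExpC (f z) w :=
  (hf.pow (weight w)).mul (isSlow_const _)

theorem isDecaying_inv : IsDecaying fun z => z⁻¹ := by
  refine ⟨1, one_pos, 1, zero_le_one, fun z _ hy => ?_⟩
  rw [norm_inv, Real.rpow_neg_one, one_mul]
  exact inv_anti₀ (by linarith) (Complex.abs_im_le_norm z)

theorem norm_le_two_mul_im {z : ℂ} (hz : z ∈ strip) (hy : 1 ≤ |z.im|) : ‖z‖ ≤ 2 * |z.im| := by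
  have h : |z.re| < 3 / 4 := hz
  have := Complex.norm_le_abs_re_add_abs_im z
  linarith

/-- With `t = min s 1`, interpolation bounds the terms by `|z| n^{-(1+t)} |Im z|^{-(1-t)}`. They are
summable in `n`, and `|z| ≤ 2 |Im z|` leaves growth `|Im z|^t`. -/
theorem isSlow_hurwitz_one : IsSlow (hurwitz [1]) := by
  intro s hs
  have ht : 0 < min s 1 := lt_min hs one_pos
  have ht1 : min s 1 ≤ 1 := min_le_right s 1
  have hsum : Summable fun n : ℕ => ((n : ℝ) + 1) ^ (-(2 - (1 - min s 1))) :=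
    summable_succ_rpow (by linarith)
  have hnn : ∀ n : ℕ, 0 ≤ ((n : ℝ) + 1) ^ (-(2 - (1 - min s 1))) := fun n => by positivity
  refine ⟨8 * ∑' n : ℕ, ((n : ℝ) + 1) ^ (-(2 - (1 - min s 1))),
    mul_nonneg (by norm_num) (tsum_nonneg hnn), fun z hz hy => ?_⟩
  have h0 : 0 < |z.im| := by linarith
  refine le_of_tendsto (tendsto_hurwitz_at [1] hz).norm (Eventually.of_forall fun N => ?_)
  rw [regTrunc_one]
  refine (norm_sum_le_of_le _ fun n _ =>
    norm_recip_sub_le hz n (s := 1 - min s 1) (by linarith) (by linarith)).trans ?_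
  rw [max_eq_right hy, ← Finset.mul_sum, ← Finset.sum_mul, ← Finset.mul_sum]
  have h1 := hsum.sum_le_tsum (Finset.range N) fun n _ => hnn n
  calc ‖z‖ * (4 * (∑ n ∈ Finset.range N, ((n : ℝ) + 1) ^ (-(2 - (1 - min s 1)))) *
        |z.im| ^ (-(1 - min s 1)))
      ≤ (2 * |z.im|) * (4 * (∑' n : ℕ, ((n : ℝ) + 1) ^ (-(2 - (1 - min s 1)))) *
        |z.im| ^ (-(1 - min s 1))) := by
        have h2 := norm_le_two_mul_im hz hy
        gcongr
    _ = (8 * ∑' n : ℕ, ((n : ℝ) + 1) ^ (-(2 - (1 - min s 1)))) * |z.im| ^ (min s 1) := by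
        rw [show |z.im| ^ (min s 1) = |z.im| * |z.im| ^ (-(1 - min s 1)) by
          rw [← Real.rpow_one_add' h0.le (by linarith)]; congr 1; ring]
        ring
    _ ≤ _ := by
        refine mul_le_mul_of_nonneg_left ?_ (mul_nonneg (by norm_num) (tsum_nonneg hnn))
        exact Real.rpow_le_rpow_of_exponent_le hy (min_le_left s 1)

theorem isDecaying_hurwitz_append_singleton (u : List ℕ+) {a : ℕ+} (ha : a ≠ 1) :
    IsDecaying (hurwitz (u ++ [a])) := by
  obtain ⟨C, hC, h⟩ := exists_norm_harm_mul_le u a ha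
  have hsum : Summable fun n : ℕ => ((n : ℝ) + 1) ^ (-(3 / 2) : ℝ) :=
    summable_succ_rpow (by norm_num)
  have hnn : ∀ n : ℕ, 0 ≤ ((n : ℝ) + 1) ^ (-(3 / 2) : ℝ) := fun n => by positivity
  refine ⟨1 / 4, by norm_num, C * ∑' n : ℕ, ((n : ℝ) + 1) ^ (-(3 / 2) : ℝ),
    mul_nonneg hC (tsum_nonneg hnn), fun z hz hy => ?_⟩
  refine le_of_tendsto (tendsto_hurwitz_at _ hz).norm (Eventually.of_forall fun N => ?_)
  rw [regTrunc_append_singleton N z u ha]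
  refine (norm_sum_le_of_le _ fun n _ => h n z hz).trans ?_
  rw [max_eq_right hy, ← Finset.sum_mul, ← Finset.mul_sum]
  have h1 := hsum.sum_le_tsum (Finset.range N) fun n _ => hnn n
  gcongr

/-- Up to decaying terms, a regularized multiple Hurwitz zeta function is given by the one of
the word `(1)`. -/
theorem isDecaying_hurwitz_sub (w : List ℕ+) :
    IsDecaying fun z => hurwitz w z - oneExpC (hurwitz [1] z) w := by
  induction w using stuffle_induction with
  | hadm k hk =>
    rcases eq_or_ne k [] with rfl | h0
    · refine isDecaying_zero.congr fun z hz _ => ?_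
      rw [(isChar_hurwitz hz).nil, oneExpC_nil, sub_self]
    · obtain ⟨u, a, ha, rfl⟩ := eq_append_singleton_of_admissible hk h0
      refine (isDecaying_hurwitz_append_singleton u ha).congr fun z hz _ => ?_
      rw [oneExpC_of_mem (x := a) (by simp) ha, sub_zero]
  | hstep n u w M hu hM ih =>
    -- Both sides are characters with the same value at `(1)`, so their recursions subtract: a
    -- decaying difference times a slowly growing function, minus decaying terms.
    refine ((isSlow_const ((n + 1 : ℕ) : ℂ)⁻¹).mul_decaying
      ((hu.mul isSlow_hurwitz_one).sub (isDecaying_multiset_sum ih))).congr fun z hz _ => ?_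
    have h1 := (isChar_hurwitz hz).step hM
    have h2 := (isChar_oneExpC (hurwitz [1] z)).step hM
    have h3 : oneExpC (hurwitz [1] z) [1] = hurwitz [1] z := by
      simpa using oneExpC_replicate (hurwitz [1] z) 1
    have h4 : (M.map fun w => hurwitz w z - oneExpC (hurwitz [1] z) w).sum
        = (M.map fun w => hurwitz w z).sum - (M.map (oneExpC (hurwitz [1] z))).sum :=
      Multiset.sum_map_sub
    have hn : ((n + 1 : ℕ) : ℂ) ≠ 0 := by exact_mod_cast n.succ_ne_zero
    rw [h3] at h2
    rw [inv_mul_eq_iff_eq_mul₀ hn, h4]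
    linear_combination h2 - h1

theorem isSlow_hurwitz (w : List ℕ+) : IsSlow (hurwitz w) := by
  have h := (isDecaying_hurwitz_sub w).isSlow.add (isSlow_hurwitz_one.oneExpC w)
  simpa using h

/-! Multitangent functions -/

/-- The part of the multitangent function with positive `m_i`, which decrease. -/
noncomputable def posSum (z : ℂ) (w : List ℕ+) : ℂ := hurwitz w.reverse z

/-- The part of the multitangent function with negative `m_i`, which decrease. -/
noncomputable def negSum (z : ℂ) (w : List ℕ+) : ℂ := (-1) ^ weight w * hurwitz w (-z)

/-- The regularized multitangent function
`∑_{m_1 > ⋯ > m_d} 1 / ((z + m_1) ^ k_1 ⋯ (z + m_d) ^ k_d)` on the strip. -/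
noncomputable def multitangent (w : List ℕ+) (z : ℂ) : ℂ :=
  conv (posSum z) (conv (letter z⁻¹) (negSum z)) w

/-- Under the shift the factor `letter z⁻¹` is absorbed into `posSum`, while `negSum` releases the
factor `letter (z - 1)⁻¹` that takes its place. -/
theorem multitangent_sub_one {z : ℂ} (hz : z ∈ strip) (hz1 : z - 1 ∈ strip) (w : List ℕ+) :
    multitangent w (z - 1) = multitangent w z := by
  have h1 : posSum (z - 1) = conv (posSum z) (letter z⁻¹) := by
    funext w
    rw [posSum, hurwitz_sub_one hz hz1, conv_reverse]
    simp only [letter_reverse]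
    rfl
  have h2 : negSum z = conv (letter (z - 1)⁻¹) (negSum (z - 1)) := by
    funext w
    have h := hurwitz_sub_one (z := -(z - 1)) (neg_mem_strip hz1)
      (by convert! neg_mem_strip hz using 1; ring) w
    rw [show -(z - 1) - 1 = -z by ring] at h
    rw [negSum, h]
    rcases w with _ | ⟨a, w⟩
    · simp [conv_letter_nil, negSum]
    · have : (-1 : ℂ) ^ (a : ℕ) * (-1) ^ (a : ℕ) = 1 := by rw [← mul_pow]; simp
      rw [conv_letter_cons, conv_letter_cons, negSum, negSum, weight_cons, pow_add, inv_neg,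
        neg_pow (z - 1)⁻¹]
      linear_combination ((z - 1)⁻¹ ^ (a : ℕ) * ((-1) ^ weight w * hurwitz w (-(z - 1)))) * this
  have h3 : multitangent w z = conv (posSum z) (conv (letter z⁻¹) (negSum z)) w := rfl
  have h4 : multitangent w (z - 1)
    = conv (posSum (z - 1)) (conv (letter (z - 1)⁻¹) (negSum (z - 1))) w := rfl
  rw [h3, h4, ← h2, h1, conv_assoc]

theorem multitangent_eq (w : List ℕ+) (z : ℂ) :
    multitangent w z = conv (posSum z) (negSum z) w + ∑ j : Fin w.length,
      z⁻¹ ^ (w.get j : ℕ) * (posSum z (w.take j) * negSum z (w.drop ((j : ℕ) + 1))) :=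
  conv_conv_letter _ _ _ _

theorem differentiableOn_posSum (w : List ℕ+) : DifferentiableOn ℂ (fun z => posSum z w) strip :=
  differentiableOn_hurwitz _

theorem differentiableOn_negSum (w : List ℕ+) :
    DifferentiableOn ℂ (fun z => negSum z w) strip :=
  ((differentiableOn_hurwitz w).comp (differentiableOn_neg _) fun _ => neg_mem_strip).const_mul _

theorem differentiableOn_conv_posSum_negSum (w : List ℕ+) :
    DifferentiableOn ℂ (fun z => conv (posSum z) (negSum z) w) strip := by
  unfold conv
  exact DifferentiableOn.fun_sum fun i _ =>
    (differentiableOn_posSum _).mul (differentiableOn_negSum _)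

theorem differentiableOn_multitangent (w : List ℕ+) :
    DifferentiableOn ℂ (multitangent w) (strip \ {0}) := by
  have h : DifferentiableOn ℂ (fun z : ℂ => z⁻¹) (strip \ {0}) :=
    differentiableOn_inv.mono fun z hz => hz.2
  have e : multitangent w = fun z => _ := funext fun z => multitangent_eq w z
  rw [e]
  refine ((differentiableOn_conv_posSum_negSum w).mono Set.sdiff_subset).add
    (DifferentiableOn.fun_sum fun j _ => (h.pow _).mul (DifferentiableOn.mul ?_ ?_))
  · exact (differentiableOn_posSum _).mono Set.sdiff_subset
  · exact (differentiableOn_negSum _).mono Set.sdiff_subset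

/-- The function `π cot (π z) - 1 / z`. -/
noncomputable def cotPart (z : ℂ) : ℂ := hurwitz [1] z - hurwitz [1] (-z)

theorem isDecaying_posSum_sub (w : List ℕ+) :
    IsDecaying fun z => posSum z w - oneExpC (hurwitz [1] z) w := by
  refine (isDecaying_hurwitz_sub w.reverse).congr fun z _ _ => ?_
  rw [oneExpC_reverse]
  rfl

theorem isDecaying_negSum_sub (w : List ℕ+) :
    IsDecaying fun z => negSum z w - oneExpC (-hurwitz [1] (-z)) w := by
  refine ((isSlow_const ((-1) ^ weight w)).mul_decaying
    (isDecaying_hurwitz_sub w).comp_neg).congr fun z _ _ => ?_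
  rw [negSum, oneExpC, oneExpC, neg_pow (hurwitz [1] (-z))]
  ring

theorem isSlow_posSum (w : List ℕ+) : IsSlow fun z => posSum z w := isSlow_hurwitz _

theorem isSlow_negSum (w : List ℕ+) : IsSlow fun z => negSum z w :=
  (isSlow_const _).mul (isSlow_hurwitz w).comp_neg

/-- Up to decay the outer factors are exponentials of `hurwitz [1] z` and `-hurwitz [1] (-z)`, which
multiply to that of `cotPart z`. They are replaced one at a time; the terms with `z⁻¹` decay because
every exponent is positive. -/
theorem isDecaying_multitangent_sub (w : List ℕ+) :
    IsDecaying fun z => multitangent w z - oneExpC (cotPart z) w := by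
  have h1 : IsDecaying fun z => ∑ i ∈ Finset.range (w.length + 1),
      ((posSum z (w.take i) - oneExpC (hurwitz [1] z) (w.take i)) * negSum z (w.drop i)
        + oneExpC (hurwitz [1] z) (w.take i)
          * (negSum z (w.drop i) - oneExpC (-hurwitz [1] (-z)) (w.drop i))) :=
    isDecaying_sum fun i _ => ((isDecaying_posSum_sub _).mul (isSlow_negSum _)).add
      ((isSlow_hurwitz_one.oneExpC _).mul_decaying (isDecaying_negSum_sub _))
  have h2 : IsDecaying fun z => ∑ j : Fin w.length,
      z⁻¹ ^ (w.get j : ℕ) * (posSum z (w.take j) * negSum z (w.drop ((j : ℕ) + 1))) := by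
    refine isDecaying_sum fun j _ => IsDecaying.mul ?_ ((isSlow_posSum _).mul (isSlow_negSum _))
    obtain ⟨n, hn⟩ := Nat.exists_eq_succ_of_ne_zero (w.get j).pos.ne'
    rw [hn]
    simp only [pow_succ]
    exact (isDecaying_inv.isSlow.pow n).mul_decaying isDecaying_inv
  refine (h1.add h2).congr fun z _ _ => ?_
  rw [multitangent_eq, cotPart, sub_eq_add_neg (hurwitz [1] z), ← conv_oneExpC, conv, conv]
  have : ∑ i ∈ Finset.range (w.length + 1),
      ((posSum z (w.take i) - oneExpC (hurwitz [1] z) (w.take i)) * negSum z (w.drop i)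
        + oneExpC (hurwitz [1] z) (w.take i)
          * (negSum z (w.drop i) - oneExpC (-hurwitz [1] (-z)) (w.drop i)))
      = ∑ i ∈ Finset.range (w.length + 1), posSum z (w.take i) * negSum z (w.drop i)
        - ∑ i ∈ Finset.range (w.length + 1), oneExpC (hurwitz [1] z) (w.take i)
          * oneExpC (-hurwitz [1] (-z)) (w.drop i) := by
    rw [← Finset.sum_sub_distrib]
    exact Finset.sum_congr rfl fun i _ => by ring
  rw [this]
  ring

theorem cotPart_neg (z : ℂ) : cotPart (-z) = -cotPart z := by simp [cotPart]

theorem cotPart_eq {z : ℂ} (hz : z ∈ strip) (hz0 : z.im ≠ 0) :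
    cotPart z = Real.pi * Complex.cot (Real.pi * z) - 1 / z := by
  have hint : z ∈ Complex.integerComplement := by
    rintro ⟨n, rfl⟩
    simp at hz0
  have h1 := tendsto_logDeriv_euler_cot_sub hint
  have h2 := (tendsto_hurwitz_at [1] hz).sub (tendsto_hurwitz_at [1] (neg_mem_strip hz))
  refine tendsto_nhds_unique h2 (h1.congr fun N => ?_)
  rw [regTrunc_one, regTrunc_one, ← Finset.sum_sub_distrib]
  refine Finset.sum_congr rfl fun n _ => ?_
  have e : (z - (n + 1)) = -(((n + 1 : ℕ) : ℂ) + -z) := by push_cast; ring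
  rw [cotTerm, e, recip, recip, one_div, inv_neg]
  push_cast
  ring

theorem pi_mul_cot_eq (z : ℂ) (q : ℂ) (hq : q = Complex.exp (2 * Complex.I * (Real.pi * z))) :
    Real.pi * Complex.cot (Real.pi * z) = -(Real.pi * Complex.I) * ((q + 1) / (1 - q)) := by
  rw [Complex.cot_eq_exp_ratio, ← hq]
  have := Complex.I_mul_I
  rw [div_mul_eq_div_div_swap, div_eq_mul_inv _ Complex.I, Complex.inv_I]
  ring

theorem norm_exp_eq (z : ℂ) :
    ‖Complex.exp (2 * Complex.I * (Real.pi * z))‖ = Real.exp (-(2 * Real.pi * z.im)) := by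
  rw [Complex.norm_exp]
  congr 1
  simp
  ring

theorem exists_norm_cotPart_le : ∃ C, ∀ z ∈ strip, 1 ≤ |z.im| → ‖cotPart z‖ ≤ C := by
  -- For `Im z ≥ 1` one has `|q| ≤ 1 / 2`, so the quotient `(q + 1) / (1 - q)` is at most `3` in
  -- norm, and `1 / z` at most `1`.
  have hpos : ∀ z ∈ strip, 1 ≤ z.im → ‖cotPart z‖ ≤ Real.pi * 3 + 1 := by
    intro z hz hy
    rw [cotPart_eq hz (by linarith), pi_mul_cot_eq z _ rfl]
    set q := Complex.exp (2 * Complex.I * (Real.pi * z)) with hqdef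
    have hq : ‖q‖ ≤ 1 / 2 := by
      rw [hqdef, norm_exp_eq, Real.exp_neg, ← one_div]
      refine one_div_le_one_div_of_le (by norm_num) ?_
      have h1 := Real.add_one_le_exp (2 * Real.pi * z.im)
      have h2 := Real.pi_gt_three
      nlinarith
    have h1 : ‖q + 1‖ ≤ 3 / 2 := by
      refine (norm_add_le _ _).trans ?_
      rw [norm_one]
      linarith
    have h2 : 1 / 2 ≤ ‖1 - q‖ := by
      have := norm_sub_norm_le 1 q
      rw [norm_one] at this
      linarith
    refine (norm_sub_le _ _).trans (add_le_add ?_ ?_)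
    · rw [norm_mul, norm_div, norm_neg, norm_mul, Complex.norm_I, Complex.norm_real,
        Real.norm_of_nonneg Real.pi_pos.le, mul_one]
      refine mul_le_mul_of_nonneg_left ?_ Real.pi_pos.le
      rw [div_le_iff₀ (by linarith)]
      linarith
    · rw [norm_div, norm_one]
      have h3 := (le_abs_self _).trans (Complex.abs_im_le_norm z)
      rw [div_le_one (by linarith)]
      linarith
  refine ⟨Real.pi * 3 + 1, fun z hz hy => ?_⟩
  rcases le_abs'.1 hy with h | h
  · rw [← norm_neg, ← cotPart_neg]
    exact hpos (-z) (neg_mem_strip hz) (by simpa using (by linarith : (1 : ℝ) ≤ -z.im))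
  · exact hpos z hz h

theorem mul_I_mem_strip (y : ℝ) : (y : ℂ) * Complex.I ∈ strip := by
  norm_num [strip]

theorem tendsto_cotPart :
    Tendsto (fun y : ℝ => cotPart (y * Complex.I)) atTop (𝓝 (-(Real.pi * Complex.I))) := by
  have hq : Tendsto (fun y : ℝ => Complex.exp (2 * Complex.I * (Real.pi * (y * Complex.I)))) atTop
      (𝓝 0) := by
    rw [tendsto_zero_iff_norm_tendsto_zero]
    simp only [norm_exp_eq, Complex.im_ofReal_mul, Complex.I_im, mul_one]
    exact Real.tendsto_exp_neg_atTop_nhds_zero.comp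
      (tendsto_id.const_mul_atTop (by positivity))
  have hz : Tendsto (fun y : ℝ => 1 / ((y : ℂ) * Complex.I)) atTop (𝓝 0) := by
    rw [tendsto_zero_iff_norm_tendsto_zero]
    simpa [Pi.inv_def] using (tendsto_abs_atTop_atTop (G := ℝ)).inv_tendsto_atTop
  have h := (((hq.add_const 1).div (tendsto_const_nhds.sub hq)
    (by norm_num : (1 : ℂ) - 0 ≠ 0)).const_mul (-(Real.pi * Complex.I))).sub hz
  simp only [zero_add, sub_zero, div_one, mul_one] at h
  refine h.congr' ?_
  filter_upwards [eventually_gt_atTop 0] with y hy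
  rw [cotPart_eq (mul_I_mem_strip y) (by simpa using hy.ne'), pi_mul_cot_eq _ _ rfl]
  rfl

theorem tendsto_oneExpC {f : ℝ → ℂ} {c : ℂ} (h : Tendsto f atTop (𝓝 c)) (w : List ℕ+) :
    Tendsto (fun y => oneExpC (f y) w) atTop (𝓝 (oneExpC c w)) :=
  (h.pow _).mul_const _

theorem IsDecaying.tendsto {f : ℂ → ℂ} (hf : IsDecaying f) :
    Tendsto (fun y : ℝ => f (y * Complex.I)) atTop (𝓝 0) := by
  obtain ⟨s, hs, C, hC, hf⟩ := hf
  have h := (tendsto_rpow_neg_atTop hs).const_mul C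
  rw [mul_zero] at h
  refine squeeze_zero_norm' ?_ h
  filter_upwards [eventually_ge_atTop 1] with y hy
  have := hf (y * Complex.I) (mul_I_mem_strip y) (by simpa using hy.trans (le_abs_self y))
  simpa [abs_of_nonneg (zero_le_one.trans hy)] using this

theorem tendsto_multitangent (w : List ℕ+) :
    Tendsto (fun y : ℝ => multitangent w (y * Complex.I)) atTop
      (𝓝 (oneExpC (-(Real.pi * Complex.I)) w)) := by
  have h := (isDecaying_multitangent_sub w).tendsto.add (tendsto_oneExpC tendsto_cotPart w)
  simpa using h

theorem tendsto_multitangent_neg (w : List ℕ+) :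
    Tendsto (fun y : ℝ => multitangent w (-(y * Complex.I))) atTop
      (𝓝 (oneExpC (Real.pi * Complex.I) w)) := by
  have h1 : Tendsto (fun y : ℝ => cotPart (-(y * Complex.I))) atTop (𝓝 (Real.pi * Complex.I)) := by
    simpa only [cotPart_neg, neg_neg] using tendsto_cotPart.neg
  have h := (isDecaying_multitangent_sub w).comp_neg.tendsto.add (tendsto_oneExpC h1 w)
  simpa using h

theorem exists_norm_multitangent_le (w : List ℕ+) :
    ∃ C, ∀ z ∈ strip, 1 ≤ |z.im| → ‖multitangent w z‖ ≤ C := by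
  obtain ⟨s, hs, C, hC, h⟩ := isDecaying_multitangent_sub w
  obtain ⟨D, hD⟩ := exists_norm_cotPart_le
  refine ⟨C + D ^ weight w * ‖(oneExp 1 w : ℂ)‖, fun z hz hy => ?_⟩
  have e : multitangent w z = (multitangent w z - oneExpC (cotPart z) w) + oneExpC (cotPart z) w := by
    ring
  rw [e]
  refine norm_add_le_of_le ((h z hz hy).trans ?_) ?_
  · exact mul_le_of_le_one_right hC (Real.rpow_le_one_of_one_le_of_nonpos hy (by linarith))
  · rw [oneExpC, norm_mul, norm_pow]
    gcongr
    exact hD z hz hy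

/-! ### Liouville's theorem, principal parts and the reduction to monotangent functions -/

/-- Liouville's theorem for functions of period `1`. -/
theorem eq_of_periodic_of_bounded {F : ℂ → ℂ} (hF : DifferentiableOn ℂ F strip)
    (hper : ∀ z ∈ strip, z - 1 ∈ strip → F (z - 1) = F z) {C : ℝ}
    (hC : ∀ z ∈ strip, 1 ≤ |z.im| → ‖F z‖ ≤ C) {z w : ℂ} (hz : z ∈ strip) (hw : w ∈ strip) :
    F z = F w := by
  have hre : ∀ (z : ℂ) (n : ℤ), (z - n).re = z.re - n := fun z n => by simp
  have hmem : ∀ (z : ℂ) (n : ℤ), z - n ∈ strip ↔ |z.re - n| < 3 / 4 := fun z n => by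
    rw [← hre]; rfl
  -- The periodic extension; rounding lands in `|Re z| ≤ 1 / 2`, well inside the strip.
  let E : ℂ → ℂ := fun z => F (z - (round z.re : ℤ))
  have hE : ∀ (z : ℂ) (n : ℤ), z - n ∈ strip → E z = F (z - n) := by
    intro z n hn
    have h1 := abs_sub_round z.re
    have h2 := (hmem z n).1 hn
    have h3 : z - (round z.re : ℤ) ∈ strip := (hmem _ _).2 (by linarith)
    change F _ = F _
    generalize round z.re = m at *
    -- Two translates in the strip, one of them rounded, differ by less than `3 / 4 + 1 / 2`; the
    -- integers thus differ by at most `1`, and a single use of periodicity suffices.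
    have h4 : |(m : ℝ) - n| < 2 := by
      rw [show (m : ℝ) - n = (z.re - n) - (z.re - m) by ring]
      have := abs_sub (z.re - n) (z.re - m)
      linarith
    have h5 : |m - n| < 2 := by exact_mod_cast h4
    obtain ⟨h6, h7⟩ := abs_lt.1 h5
    obtain rfl | rfl | rfl : m = n ∨ m = n + 1 ∨ m = n - 1 := by omega
    · rfl
    · have e : z - ((n + 1 : ℤ) : ℂ) = z - n - 1 := by push_cast; ring
      rw [e] at h3 ⊢
      exact hper _ hn h3
    · have e : z - n = z - ((n - 1 : ℤ) : ℂ) - 1 := by push_cast; ring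
      rw [e] at hn ⊢
      exact (hper _ h3 hn).symm
  have hstrip : ∀ z ∈ strip, E z = F z := fun z hz => by
    simpa using hE z 0 (by simpa using hz)
  have hdiff : Differentiable ℂ E := by
    intro z₀
    have hz₀ : z₀ - (round z₀.re : ℤ) ∈ strip :=
      (hmem _ _).2 (lt_of_le_of_lt (abs_sub_round z₀.re) (by norm_num))
    have h1 : DifferentiableAt ℂ (fun z : ℂ => F (z - (round z₀.re : ℤ))) z₀ :=
      (hF.differentiableAt (isOpen_strip.mem_nhds hz₀)).comp z₀
        (differentiableAt_id.sub_const _)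
    refine h1.congr_of_eventuallyEq ?_
    have h2 : ∀ᶠ z : ℂ in 𝓝 z₀, z - ((round z₀.re : ℤ) : ℂ) ∈ strip :=
      (continuous_id.sub continuous_const).continuousAt.eventually_mem (isOpen_strip.mem_nhds hz₀)
    filter_upwards [h2] with z hz using hE z _ hz
  have hbdd : Bornology.IsBounded (Set.range E) := by
    have hK : IsCompact (Set.Icc (-(1 / 2) : ℝ) (1 / 2) ×ℂ Set.Icc (-1 : ℝ) 1) :=
      isCompact_Icc.reProdIm isCompact_Icc
    have hsub : Set.Icc (-(1 / 2) : ℝ) (1 / 2) ×ℂ Set.Icc (-1 : ℝ) 1 ⊆ strip := fun z hz =>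
      lt_of_le_of_lt (abs_le.2 (Complex.mem_reProdIm.1 hz).1) (by norm_num)
    obtain ⟨D, hD⟩ := hK.exists_bound_of_continuousOn (hF.continuousOn.mono hsub)
    refine isBounded_iff_forall_norm_le.2 ⟨max C D, ?_⟩
    rintro _ ⟨z, rfl⟩
    have h1 := abs_sub_round z.re
    rcases le_total 1 |z.im| with h | h
    · refine (hC _ ((hmem _ _).2 (by linarith)) (by simpa using h)).trans (le_max_left _ _)
    · refine (hD _ (Complex.mem_reProdIm.2 ⟨?_, ?_⟩)).trans (le_max_right _ _)
      · rw [hre]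
        exact abs_le.1 h1
      · simpa using abs_le.1 h
  rw [← hstrip z hz, ← hstrip w hw]
  exact hdiff.apply_eq_apply_of_bounded hbdd z w

/-- Removing the principal part of `Q z / z ^ L`. -/
theorem tendsto_sub_principalPart {Q : ℂ → ℂ} {q : ℕ → ℂ} {r : ℝ} (hr : 0 < r)
    (h : ∀ z ∈ Metric.ball (0 : ℂ) r, HasSum (fun n => q n * z ^ n) (Q z)) (L : ℕ) :
    Tendsto (fun z => z⁻¹ ^ L * Q z - ∑ c ∈ Finset.range L, q (L - 1 - c) * z⁻¹ ^ (c + 1))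
      (𝓝[≠] 0) (𝓝 (q L)) := by
  have hr2 : ((r / 2 : ℝ) : ℂ) ∈ Metric.ball (0 : ℂ) r := by
    rw [mem_ball_zero_iff, Complex.norm_real, Real.norm_of_nonneg (by positivity)]
    linarith
  -- Convergence at the point `r / 2` dominates the shifted series on the ball of that radius, so
  -- its sum is continuous at `0`, with value `q L`.
  have hs : Summable fun n => ‖q (n + L)‖ * (r / 2) ^ n := by
    have h1 := ((summable_nat_add_iff L).2 (h _ hr2).summable).norm
    have h2 := h1.mul_left (((r / 2) ^ L)⁻¹)
    refine h2.congr fun n => ?_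
    rw [norm_mul, norm_pow, Complex.norm_real, Real.norm_of_nonneg (by positivity), pow_add]
    field_simp
  have hcont : ContinuousOn (fun z : ℂ => ∑' n, q (n + L) * z ^ n) (Metric.ball 0 (r / 2)) := by
    refine continuousOn_tsum (fun n => by fun_prop) hs fun n z hz => ?_
    rw [norm_mul, norm_pow]
    have := (mem_ball_zero_iff.1 hz).le
    gcongr
  have h0 := (hcont.continuousAt (Metric.ball_mem_nhds 0 (by positivity))).tendsto
  have h1 : ∑' n, q (n + L) * (0 : ℂ) ^ n = q L := by
    rw [tsum_eq_single 0 fun n hn => by simp [hn]]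
    simp
  rw [h1] at h0
  refine (h0.mono_left nhdsWithin_le_nhds).congr' ?_
  filter_upwards [self_mem_nhdsWithin, mem_nhdsWithin_of_mem_nhds (Metric.ball_mem_nhds 0 hr)]
    with z hz hzr
  have hz : z ≠ 0 := hz
  have h2 := ((hasSum_nat_add_iff' L).2 (h z hzr)).mul_left (z⁻¹ ^ L)
  have h3 : (fun n => z⁻¹ ^ L * (q (n + L) * z ^ (n + L))) = fun n => q (n + L) * z ^ n := by
    funext n
    rw [pow_add, inv_pow]
    field_simp
  rw [h3] at h2
  rw [h2.tsum_eq, mul_sub, Finset.mul_sum, ← Finset.sum_range_reflect]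
  congr 1
  refine Finset.sum_congr rfl fun c hc => ?_
  have hc := Finset.mem_range.1 hc
  have h4 : z⁻¹ ^ L = z⁻¹ ^ (c + 1) * z⁻¹ ^ (L - 1 - c) := by
    rw [← pow_add]; congr 1; omega
  have h5 : z⁻¹ ^ (L - 1 - c) * z ^ (L - 1 - c) = 1 := by
    rw [← mul_pow, inv_mul_cancel₀ hz, one_pow]
  rw [h4]
  linear_combination (q (L - 1 - c) * z⁻¹ ^ (c + 1)) * h5

/-- The Taylor coefficients of the product of `posSum` at `u` and `negSum` at `v`. -/
noncomputable def prodCoeff (u v : List ℕ+) (n : ℕ) : ℂ :=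
  ∑ p ∈ Finset.HasAntidiagonal.antidiagonal n, (zetaRegCoeff p.1 u.reverse : ℂ) *
    ((-1) ^ (weight v + p.2) * (zetaRegCoeff p.2 v : ℂ))

theorem hasSum_posSum_mul_negSum (u v : List ℕ+) {z : ℂ}
    (hz : z ∈ Metric.ball (0 : ℂ) (3 / 4)) :
    HasSum (fun n => prodCoeff u v n * z ^ n) (posSum z u * negSum z v) := by
  have hz' : -z ∈ Metric.ball (0 : ℂ) (3 / 4) := by simpa using hz
  have h1 := hasSum_hurwitz u.reverse hz
  have h2 : HasSum (fun a : ℕ => ((-1) ^ (weight v + a) * (zetaRegCoeff a v : ℂ)) * z ^ a)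
      (negSum z v) := by
    refine ((hasSum_hurwitz v hz').mul_left ((-1) ^ weight v)).congr_fun ?_
    intro a
    rw [neg_pow, pow_add]
    ring
  have h3 := (summable_norm_sum_mul_antidiagonal_of_summable_norm h1.summable.norm
    h2.summable.norm).of_norm.hasSum
  rw [← tsum_mul_tsum_eq_tsum_sum_antidiagonal_of_summable_norm h1.summable.norm h2.summable.norm,
    h1.tsum_eq, h2.tsum_eq] at h3
  refine h3.congr_fun ?_
  intro n
  rw [prodCoeff, Finset.sum_mul]
  refine Finset.sum_congr rfl fun p hp => ?_
  rw [← Finset.HasAntidiagonal.mem_antidiagonal.1 hp, pow_add]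
  ring

theorem posSum_nil {z : ℂ} (hz : z ∈ strip) : posSum z [] = 1 := (isChar_hurwitz hz).nil

theorem negSum_nil {z : ℂ} (hz : z ∈ strip) : negSum z [] = 1 := by
  rw [negSum, (isChar_hurwitz (neg_mem_strip hz)).nil, weight_nil, pow_zero, one_mul]

theorem multitangent_singleton {z : ℂ} (hz : z ∈ strip) (a : ℕ+) :
    multitangent [a] z = conv (posSum z) (negSum z) [a] + z⁻¹ ^ (a : ℕ) := by
  have h : ∑ j : Fin [a].length, z⁻¹ ^ ([a].get j : ℕ) *
      (posSum z ([a].take j) * negSum z ([a].drop ((j : ℕ) + 1)))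
      = z⁻¹ ^ (a : ℕ) * (posSum z [] * negSum z []) :=
    Fin.sum_univ_one _
  rw [multitangent_eq, h, posSum_nil hz, negSum_nil hz, mul_one, mul_one]

/-- This removes the monotangent functions from the mean of the limits at `±i∞`. -/
theorem oneExpC_singleton_neg (c : ℂ) (a : ℕ+) : oneExpC (-c) [a] + oneExpC c [a] = 0 := by
  by_cases ha : a = 1
  · subst ha
    have h := fun c => oneExpC_replicate c 1
    simp only [List.replicate_one] at h
    rw [h, h]
    simp
  · rw [oneExpC_of_mem (x := a) (by simp) ha, oneExpC_of_mem (x := a) (by simp) ha, add_zero]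

/-- `δ` lists the coefficients of the cosine, the mean of the exponentials with parameters `±πi`. -/
theorem two_mul_delta (w : List ℕ+) :
    2 * (delta w : ℂ) = oneExpC (-(Real.pi * Complex.I)) w + oneExpC (Real.pi * Complex.I) w := by
  by_cases h : ∀ x ∈ w, x = 1
  · rw [List.eq_replicate_of_mem h, oneExpC_replicate, oneExpC_replicate]
    generalize w.length = n
    rw [delta, List.length_replicate]
    rcases n.even_or_odd with hn | hn
    · rw [if_pos ⟨hn, fun x hx => List.eq_of_mem_replicate hx⟩, hn.neg_pow, mul_pow]
      obtain ⟨m, rfl⟩ := hn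
      have : Complex.I ^ (m + m) = (-1) ^ ((m + m) / 2) := by
        rw [← two_mul, pow_mul, Complex.I_sq, Nat.mul_div_cancel_left _ two_pos]
      rw [this]
      push_cast
      ring
    · rw [if_neg fun h => Nat.not_even_iff_odd.2 hn h.1, hn.neg_pow]
      simp only [Complex.ofReal_zero]
      ring
  · rw [delta, if_neg fun h' => h h'.2]
    push Not at h
    obtain ⟨x, hx, hx1⟩ := h
    rw [oneExpC_of_mem hx hx1, oneExpC_of_mem hx hx1]
    simp

/-- The constant terms at `0` of the reduction of multitangent functions to monotangent ones. -/
theorem multitangent_reduction (w : List ℕ+) :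
    conv (posSum 0) (negSum 0) w + ∑ j : Fin w.length,
      (prodCoeff (w.take j) (w.drop ((j : ℕ) + 1)) (w.get j : ℕ)
        - ∑ c ∈ Finset.range (w.get j : ℕ),
          prodCoeff (w.take j) (w.drop ((j : ℕ) + 1)) ((w.get j : ℕ) - 1 - c)
            * conv (posSum 0) (negSum 0) [c.succPNat]) = (delta w : ℂ) := by
  let q : Fin w.length → ℕ → ℂ := fun j => prodCoeff (w.take j) (w.drop ((j : ℕ) + 1))
  -- The index `c` stands for the pole `z^{-(c+1)}`; its coefficient in `z^{-k_j}` times the product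
  -- with coefficients `q j` is that of `z^{k_j-1-c}`.
  let S : (ℕ+ → ℂ) → ℂ := fun f => ∑ j : Fin w.length, ∑ c ∈ Finset.range (w.get j : ℕ),
    q j ((w.get j : ℕ) - 1 - c) * f c.succPNat
  let T : ℂ → ℂ := fun z => multitangent w z - S fun a => multitangent [a] z
  let e : ℂ := conv (posSum 0) (negSum 0) w + ∑ j : Fin w.length, (q j (w.get j : ℕ)
        - ∑ c ∈ Finset.range (w.get j : ℕ), q j ((w.get j : ℕ) - 1 - c)
            * conv (posSum 0) (negSum 0) [c.succPNat])
  change e = _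
  have hS : ∀ {f : ℕ+ → ℝ → ℂ} {g : ℕ+ → ℂ} {l : Filter ℝ}, (∀ a, Tendsto (f a) l (𝓝 (g a))) →
      Tendsto (fun y => S fun a => f a y) l (𝓝 (S g)) := fun h =>
    tendsto_finsetSum _ fun j _ => tendsto_finsetSum _ fun c _ => (h _).const_mul _
  have hconv : ∀ u, Tendsto (fun z => conv (posSum z) (negSum z) u) (𝓝[≠] 0)
      (𝓝 (conv (posSum 0) (negSum 0) u)) := fun u =>
    (((differentiableOn_conv_posSum_negSum u).differentiableAt
      (isOpen_strip.mem_nhds zero_mem_strip)).continuousAt.tendsto).mono_left nhdsWithin_le_nhds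
  -- Each monotangent function is a single power `z^{-(c+1)}` plus a holomorphic part, so the
  -- principal parts cancel and the holomorphic parts supply the remaining constants.
  have hlim : Tendsto T (𝓝[≠] 0) (𝓝 e) := by
    have h := (hconv w).add (tendsto_finsetSum Finset.univ fun (j : Fin w.length) _ =>
      (tendsto_sub_principalPart (by norm_num : (0 : ℝ) < 3 / 4)
        (fun z hz => hasSum_posSum_mul_negSum (w.take j) (w.drop ((j : ℕ) + 1)) hz)
        (w.get j : ℕ)).sub (tendsto_finsetSum (Finset.range (w.get j : ℕ)) fun c _ =>
          (hconv [c.succPNat]).const_mul (q j ((w.get j : ℕ) - 1 - c))))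
    refine h.congr' ?_
    filter_upwards [mem_nhdsWithin_of_mem_nhds (isOpen_strip.mem_nhds zero_mem_strip)] with z hz
    simp only [T, S, multitangent_eq w z, multitangent_singleton hz, mul_add,
      Finset.sum_add_distrib, Finset.sum_sub_distrib, Nat.succPNat_coe, Nat.succ_eq_add_one]
    simp only [q]
    ring
  let E : ℂ → ℂ := Function.update T 0 e
  have hE : ∀ z ≠ 0, E z = T z := fun z hz => Function.update_of_ne hz _ _
  have hdiff : DifferentiableOn ℂ E strip := by
    refine (Complex.differentiableOn_compl_singleton_and_continuousAt_iff
      (isOpen_strip.mem_nhds zero_mem_strip)).1 ⟨?_, continuousAt_update_same.2 hlim⟩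
    have hT : DifferentiableOn ℂ T (strip \ {0}) :=
      (differentiableOn_multitangent w).sub (DifferentiableOn.fun_sum fun j _ =>
        DifferentiableOn.fun_sum fun c _ => (differentiableOn_multitangent _).const_mul _)
    exact hT.congr fun z hz => hE z hz.2
  -- Since `1` and `-1` lie outside the strip, neither point is the origin, and the modified value
  -- of `E` plays no role.
  have hper : ∀ z ∈ strip, z - 1 ∈ strip → E (z - 1) = E z := by
    intro z hz hz1
    have h0 : z ≠ 0 := by rintro rfl; norm_num [strip] at hz1
    have h1 : z - 1 ≠ 0 := by
      intro h
      rw [sub_eq_zero.1 h] at hz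
      norm_num [strip] at hz
    rw [hE z h0, hE _ h1]
    simp only [T, multitangent_sub_one hz hz1]
  have hne : ∀ z : ℂ, 1 ≤ |z.im| → z ≠ 0 := by
    rintro z hz rfl
    norm_num at hz
  obtain ⟨C, hC⟩ := exists_norm_multitangent_le w
  choose D hD using fun a : ℕ+ => exists_norm_multitangent_le [a]
  have hbdd : ∀ z ∈ strip, 1 ≤ |z.im| → ‖E z‖ ≤ C + ∑ j : Fin w.length,
      ∑ c ∈ Finset.range (w.get j : ℕ), ‖q j ((w.get j : ℕ) - 1 - c)‖ * D c.succPNat := by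
    intro z hz hy
    rw [hE z (hne z hy)]
    refine (norm_sub_le _ _).trans (add_le_add (hC z hz hy) ?_)
    refine norm_sum_le_of_le _ fun j _ => norm_sum_le_of_le _ fun c _ => ?_
    rw [norm_mul]
    exact mul_le_mul_of_nonneg_left (hD _ z hz hy) (norm_nonneg _)
  have hconst : ∀ z ∈ strip, 1 ≤ |z.im| → T z = e := by
    intro z hz hy
    rw [← hE z (hne z hy), eq_of_periodic_of_bounded hdiff hper hbdd hz zero_mem_strip]
    exact Function.update_self _ _ _
  have hI : ∀ y : ℝ, 1 ≤ y → 1 ≤ |((y : ℂ) * Complex.I).im| := fun y hy => by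
    simpa using hy.trans (le_abs_self y)
  have h1 : e = oneExpC (-(Real.pi * Complex.I)) w
      - S fun a => oneExpC (-(Real.pi * Complex.I)) [a] := by
    have ht : Tendsto (fun y : ℝ => T (y * Complex.I)) atTop
        (𝓝 (oneExpC (-(Real.pi * Complex.I)) w - S fun a => oneExpC (-(Real.pi * Complex.I)) [a])) :=
      (tendsto_multitangent w).sub (hS (f := fun a y => multitangent [a] (y * Complex.I))
        (g := fun a => oneExpC (-(Real.pi * Complex.I)) [a]) fun a => tendsto_multitangent [a])
    refine tendsto_nhds_unique (tendsto_const_nhds.congr' ?_) ht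
    filter_upwards [eventually_ge_atTop 1] with y hy
    exact (hconst _ (mul_I_mem_strip y) (hI y hy)).symm
  have h2 : e = oneExpC (Real.pi * Complex.I) w
      - S fun a => oneExpC (Real.pi * Complex.I) [a] := by
    have ht : Tendsto (fun y : ℝ => T (-(y * Complex.I))) atTop
        (𝓝 (oneExpC (Real.pi * Complex.I) w - S fun a => oneExpC (Real.pi * Complex.I) [a])) :=
      (tendsto_multitangent_neg w).sub (hS (f := fun a y => multitangent [a] (-(y * Complex.I)))
        (g := fun a => oneExpC (Real.pi * Complex.I) [a]) fun a => tendsto_multitangent_neg [a])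
    refine tendsto_nhds_unique (tendsto_const_nhds.congr' ?_) ht
    filter_upwards [eventually_ge_atTop 1] with y hy
    refine (hconst _ (neg_mem_strip (mul_I_mem_strip y)) ?_).symm
    rw [Complex.neg_im, abs_neg]
    exact hI y hy
  have h3 : (S fun a => oneExpC (-(Real.pi * Complex.I)) [a])
      + (S fun a => oneExpC (Real.pi * Complex.I) [a]) = 0 := by
    simp only [S, ← Finset.sum_add_distrib, ← mul_add, oneExpC_singleton_neg, mul_zero,
      Finset.sum_const_zero]
  have h4 := two_mul_delta w
  -- The constant is the mean of its expressions at `+i∞` and `-i∞`.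
  linear_combination (1 / 2) * (h1 + h2 - h3 - h4)

/-! ### Constant terms of monotangent functions and Bernoulli numbers -/

theorem zetaReg_singleton {n : ℕ} (hn : 2 ≤ n) (a : ℕ+) (ha : (a : ℕ) = n) :
    zetaReg [a] = ∑' m : ℕ, 1 / (m : ℝ) ^ n := by
  have hadm : a ≠ 1 := by rintro rfl; simp at ha; omega
  have h0 : Summable fun m : ℕ => 1 / (m : ℝ) ^ n := Real.summable_one_div_nat_pow.2 hn
  have hsum : HasSum (fun m : ℕ => ((1 / ((m : ℝ) + 1) ^ n : ℝ) : ℂ)) (zetaReg [a] : ℂ) := by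
    have h1 := tendsto_hurwitz_at [a] zero_mem_strip
    rw [hurwitz_zero] at h1
    have h2 : Summable fun m : ℕ => ((1 / ((m : ℝ) + 1) ^ n : ℝ) : ℂ) := by
      have h := (summable_nat_add_iff 1).2 h0
      simp only [Nat.cast_add, Nat.cast_one] at h
      exact (Complex.hasSum_ofReal.2 h.hasSum).summable
    refine (h2.hasSum_iff_tendsto_nat).2 (h1.congr fun N => ?_)
    have h3 := regTrunc_append_singleton N 0 [] hadm
    rw [List.nil_append] at h3
    rw [h3]
    refine Finset.sum_congr rfl fun m _ => ?_
    rw [harm_nil, one_mul, ha, recip]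
    push_cast
    simp
  have h4 : HasSum (fun m : ℕ => 1 / ((m : ℝ) + 1) ^ n) (zetaReg [a]) := by
    exact_mod_cast hsum
  rw [h0.tsum_eq_zero_add]
  have hn0 : n ≠ 0 := by omega
  simp [← h4.tsum_eq, hn0]

/-- The values of the constant terms of the monotangent functions. -/
theorem conv_posSum_negSum_singleton (a : ℕ+) :
    conv (posSum 0) (negSum 0) [a] = (1 + (-1) ^ (a : ℕ)) * (zetaReg [a] : ℂ) := by
  have h1 : posSum 0 [] = 1 := posSum_nil zero_mem_strip
  have h2 : negSum 0 [] = 1 := negSum_nil zero_mem_strip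
  rw [conv_cons, conv_nil, h1, h2, negSum, posSum, neg_zero, List.reverse_singleton, hurwitz_zero,
    weight_cons, weight_nil, add_zero]
  ring

theorem conv_posSum_negSum_even {m : ℕ} (a : ℕ+) (ha : (a : ℕ) = 2 * m) :
    conv (posSum 0) (negSum 0) [a] = -((-1) ^ m *
      ((2 * Real.pi) ^ (2 * m) / ((2 * m).factorial : ℂ) * (bernoulli (2 * m) : ℂ))) := by
  have hm : m ≠ 0 := by
    have := a.pos
    omega
  have h := (hasSum_zeta_nat hm).tsum_eq
  have h2 : (2 : ℝ) ^ (2 * m) = 2 * 2 ^ (2 * m - 1) := by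
    rw [← pow_succ']; congr 1; omega
  have h3 : 2 * zetaReg [a] = -((-1) ^ m *
      ((2 * Real.pi) ^ (2 * m) / ((2 * m).factorial : ℝ) * (bernoulli (2 * m) : ℝ))) := by
    rw [zetaReg_singleton (by omega) a ha, h, mul_pow, h2]
    ring
  have h4 := congrArg (fun x : ℝ => (x : ℂ)) h3
  push_cast at h4
  rw [conv_posSum_negSum_singleton, ha, pow_mul, neg_one_sq, one_pow, one_add_one_eq_two, h4]

theorem conv_posSum_negSum_odd (a : ℕ+) (ha : Odd (a : ℕ)) :
    conv (posSum 0) (negSum 0) [a] = 0 := by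
  rw [conv_posSum_negSum_singleton, ha.neg_one_pow, add_neg_cancel, zero_mul]

/-- The inner sum of the theorem, for the letter `a` between the words `u` and `v`. -/
noncomputable def bernoulliSum (u : List ℕ+) (a : ℕ+) (v : List ℕ+) : ℂ :=
  ∑ t ∈ triples (a : ℕ), (-1) ^ (t.2.2 + weight v + t.2.1)
    * ((2 * Real.pi) ^ (2 * t.2.1) / ((2 * t.2.1).factorial : ℂ)) * (bernoulli (2 * t.2.1) : ℂ)
    * (zetaRegCoeff t.1 u.reverse : ℂ) * (zetaRegCoeff t.2.2 v : ℂ)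

theorem bernoulliSum_eq (u : List ℕ+) (a : ℕ+) (v : List ℕ+) :
    prodCoeff u v a - ∑ c ∈ Finset.range a, prodCoeff u v ((a : ℕ) - 1 - c)
      * conv (posSum 0) (negSum 0) [c.succPNat] = bernoulliSum u a v := by
  -- The value `1` at `0` accounts for the leading term `prodCoeff u v a`; it is the `B_0` case of
  -- the Bernoulli formula, so both terms join in one sum.
  let Y : ℕ → ℂ := fun c => if h : 0 < c then -conv (posSum 0) (negSum 0) [⟨c, h⟩] else 1
  have hY : ∀ m, Y (2 * m) = (-1) ^ m *
      ((2 * Real.pi) ^ (2 * m) / ((2 * m).factorial : ℂ) * (bernoulli (2 * m) : ℂ)) := by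
    intro m
    rcases m.eq_zero_or_pos with rfl | hm
    · simp [Y]
    · have h : 0 < 2 * m := by omega
      simp only [Y, dif_pos h]
      rw [conv_posSum_negSum_even ⟨2 * m, h⟩ rfl, neg_neg]
  have hY1 : ∀ c, ¬ Even c → Y c = 0 := by
    intro c hc
    have h : 0 < c := Nat.pos_of_ne_zero fun h => hc (by simp [h])
    simp only [Y, dif_pos h]
    rw [conv_posSum_negSum_odd ⟨c, h⟩ (Nat.not_even_iff_odd.1 hc), neg_zero]
  have h1 : prodCoeff u v a - ∑ c ∈ Finset.range a, prodCoeff u v ((a : ℕ) - 1 - c)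
      * conv (posSum 0) (negSum 0) [c.succPNat]
      = ∑ c ∈ Finset.range ((a : ℕ) + 1), Y c * prodCoeff u v ((a : ℕ) - c) := by
    rw [Finset.sum_range_succ', sub_eq_add_neg, add_comm, ← Finset.sum_neg_distrib]
    congr 1
    · refine Finset.sum_congr rfl fun c _ => ?_
      have h : Y (c + 1) = -conv (posSum 0) (negSum 0) [c.succPNat] := dif_pos c.succ_pos
      rw [h, Nat.sub_sub, add_comm 1 c]
      ring
    · simp [Y]
  rw [h1]
  simp only [prodCoeff, Finset.mul_sum]
  rw [Finset.sum_sigma', eq_comm]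
  -- The triples correspond to the even values `c = 2m`; the odd ones vanish.
  refine Finset.sum_of_injOn (fun t => (⟨2 * t.2.1, (t.1, t.2.2)⟩ : (_ : ℕ) × ℕ × ℕ)) ?_ ?_ ?_ ?_
  · rintro ⟨a, m, b⟩ _ ⟨a', m', b'⟩ _ h
    simp only [Sigma.mk.injEq, heq_eq_eq, Prod.mk.injEq] at h ⊢
    omega
  · rintro ⟨i, m, b⟩ h
    have h := mem_triples.1 h
    simp only [Finset.coe_sigma, Set.mem_sigma_iff, Finset.mem_coe, Finset.mem_range,
      Finset.HasAntidiagonal.mem_antidiagonal]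
    omega
  · rintro ⟨c, i, b⟩ h h'
    simp only [Finset.mem_sigma, Finset.mem_range, Finset.HasAntidiagonal.mem_antidiagonal] at h
    rw [hY1 c, zero_mul]
    rintro ⟨m, rfl⟩
    refine h' ⟨(i, m, b), mem_triples.2 (by omega), ?_⟩
    rw [← two_mul]
  · rintro ⟨i, m, b⟩ _
    simp only [hY]
    rw [show b + weight v + m = (weight v + b) + m by ring, pow_add _ (weight v + b)]
    ring

/-! ### Convolution with the star values and conclusion -/

/-- Cutting the word first and then marking a letter of the right part is the same as marking a
letter first and cutting at or before it. -/
theorem conv_insert {R : Type*} [CommRing R] (s : List ℕ+ → R) (T : List ℕ+ → ℕ+ → List ℕ+ → R)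
    (w : List ℕ+) :
    conv s (fun w => ∑ j : Fin w.length, T (w.take j) (w.get j) (w.drop ((j : ℕ) + 1))) w
      = ∑ j : Fin w.length, ∑ i ∈ Finset.range ((j : ℕ) + 1),
        s (w.take i) * T ((w.take j).drop i) (w.get j) (w.drop ((j : ℕ) + 1)) := by
  induction w generalizing s with
  | nil => simp [conv_nil]
  | cons a w ih =>
    rw [conv_cons, ih, Finset.mul_sum]
    refine (congrArg₂ (· + ·) (Fin.sum_univ_succ (n := w.length) _) rfl).trans
      (Eq.trans ?_ (Fin.sum_univ_succ (n := w.length) _).symm)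
    rw [add_assoc, ← Finset.sum_add_distrib]
    congr 1
    · simp
    · refine Finset.sum_congr rfl fun j _ => ?_
      rw [add_comm]
      exact (Finset.sum_range_succ' (fun i => s ((a :: w).take i)
        * T (((a :: w).take ((j : ℕ) + 1)).drop i) (w.get j) (w.drop ((j : ℕ) + 1))) _).symm

theorem conv_posSum_negSum_eq (w : List ℕ+) :
    conv (posSum 0) (negSum 0) w = (delta w : ℂ)
      - ∑ j : Fin w.length, bernoulliSum (w.take j) (w.get j) (w.drop ((j : ℕ) + 1)) := by
  rw [← multitangent_reduction]
  simp only [bernoulliSum_eq]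
  ring

end MZV

theorem theorem2p2 (k : List ℕ+) :
    (-1 : ℝ) ^ k.length * MZV.zetaStarReg k - (-1 : ℝ) ^ MZV.weight k * MZV.zetaReg k
      = -(∑ i ∈ Finset.range k.length,
            (-1 : ℝ) ^ i * MZV.zetaStarReg (k.take i) * MZV.delta (k.drop i))
        + ∑ j : Fin k.length, ∑ i ∈ Finset.range ((j : ℕ) + 1),
            ∑ t ∈ MZV.triples (k.get j : ℕ),
              (-1 : ℝ) ^ (i + t.2.2 + MZV.weight (k.drop ((j : ℕ) + 1)) + t.2.1)
                * ((2 * Real.pi) ^ (2 * t.2.1) / ((2 * t.2.1).factorial : ℝ))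
                * (bernoulli (2 * t.2.1) : ℝ)
                * MZV.zetaStarReg (k.take i)
                * MZV.zetaRegCoeff t.1 ((k.take (j : ℕ)).drop i).reverse
                * MZV.zetaRegCoeff t.2.2 (k.drop ((j : ℕ) + 1)) := by
  open MZV in
  have hs := conv_star_zetaReg
  set s : List ℕ+ → ℂ := fun u => (-1) ^ u.length * zetaStarReg u with hsdef
  have hP : (fun u : List ℕ+ => (zetaReg u.reverse : ℂ)) = posSum 0 :=
    funext fun u => (hurwitz_zero _).symm
  -- By associativity the signed star values cancel `posSum 0`, the reversed zeta values.
  have h1 : conv s (conv (posSum 0) (negSum 0)) k = (-1) ^ weight k * (zetaReg k : ℂ) := by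
    rw [← conv_assoc, ← hP, hs, conv_unit_left, negSum, neg_zero, hurwitz_zero]
  have h2 : conv (posSum 0) (negSum 0) = fun w => (delta w : ℂ)
      - ∑ j : Fin w.length, bernoulliSum (w.take j) (w.get j) (w.drop ((j : ℕ) + 1)) :=
    funext conv_posSum_negSum_eq
  -- The last cut, with empty right part and `δ = 1` there, is split off: it is the signed star
  -- value of the whole index.
  rw [h2, conv_sub_right, conv_insert s bernoulliSum, conv, Finset.sum_range_succ,
    List.take_length, List.drop_length] at h1
  have h3 : (delta [] : ℂ) = 1 := by simp [delta]
  rw [h3, mul_one] at h1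
  have h4 : ∀ i ≤ k.length, s (k.take i) = (-1) ^ i * (zetaStarReg (k.take i) : ℂ) := by
    intro i hi
    simp only [hsdef]
    rw [List.length_take, min_eq_left hi]
  have h5 : ∑ i ∈ Finset.range k.length, s (k.take i) * (delta (k.drop i) : ℂ)
      = ∑ i ∈ Finset.range k.length,
        (-1) ^ i * (zetaStarReg (k.take i) : ℂ) * (delta (k.drop i) : ℂ) :=
    Finset.sum_congr rfl fun i hi => by rw [h4 i (Finset.mem_range.1 hi).le]
  have h6 : ∑ j : Fin k.length, ∑ i ∈ Finset.range ((j : ℕ) + 1),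
      s (k.take i) * bernoulliSum ((k.take j).drop i) (k.get j) (k.drop ((j : ℕ) + 1))
      = ∑ j : Fin k.length, ∑ i ∈ Finset.range ((j : ℕ) + 1), ∑ t ∈ triples (k.get j : ℕ),
        (-1 : ℂ) ^ (i + t.2.2 + weight (k.drop ((j : ℕ) + 1)) + t.2.1)
          * ((2 * Real.pi) ^ (2 * t.2.1) / ((2 * t.2.1).factorial : ℂ))
          * (bernoulli (2 * t.2.1) : ℂ) * (zetaStarReg (k.take i) : ℂ)
          * (zetaRegCoeff t.1 ((k.take (j : ℕ)).drop i).reverse : ℂ)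
          * (zetaRegCoeff t.2.2 (k.drop ((j : ℕ) + 1)) : ℂ) := by
    refine Finset.sum_congr rfl fun j _ => Finset.sum_congr rfl fun i hi => ?_
    have hj := j.2
    have hi := Finset.mem_range.1 hi
    rw [h4 i (by omega), bernoulliSum, Finset.mul_sum]
    refine Finset.sum_congr rfl fun t _ => ?_
    rw [show i + t.2.2 + weight (k.drop ((j : ℕ) + 1)) + t.2.1
      = i + (t.2.2 + weight (k.drop ((j : ℕ) + 1)) + t.2.1) by ring, pow_add (-1 : ℂ) i]
    ring
  rw [h5, h6] at h1
  have h7 : s k = (-1) ^ k.length * (zetaStarReg k : ℂ) := rfl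
  rw [h7] at h1
  apply Complex.ofReal_injective
  push_cast
  linear_combination h1
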